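/- **Theorem 5.1.** For $c>0$ let $d(c)>0$ be defined by $e^{c}=1+\frac{d(c)^2}{4(1+d(c))}$, and let $f_c$ be the conformal map of $\Delta=\{|z|>1\}$ onto $\Delta\setminus(1,1+d(c)]$ with $f_c(z)=e^{c}z+\mathcal O(1)$ at infinity. Let $\mathbf c>0$, let $(c_k)_{k\ge 1}$ be a deterministic sequence with $0<c_k\le \mathbf c$ for all $k$, and let $(\theta_k)_{k\ge 1}$ be independent random variables, uniformly distributed on $[0,2\pi)$. Put $f_k(z)=e^{i\theta_k}f_{c_k}(e^{-i\theta_k}z)$, $\Phi_n=f_1\circ\cdots\circ f_n$ and $C_n=\sum_{k=1}^n c_k$, and let $\tilde\Phi_n(z)=\log \Phi_n(e^z)$, $\operatorname{Re} z>0$, be the holomorphic branch with $\tilde\Phi_n(z)=z+C_n+o(1)$ as $\operatorname{Re} z\to\infty$. There are absolute constants $A,A'>0$ such that, for all such $\mathbf c$, $(c_k)$ and $(\theta_k)$, all $N\in\mathbb N$, all $\sigma>0$ and all $0<\epsilon<\sigma/3$ satisfying $\sigma-3\epsilon>d(\mathbf c)\vee \mathbf c^{1/3}$, $$\mathbb P\Big(\sup_{\operatorname{Re}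 z>\sigma,\ n\le N}|\tilde\Phi_n(z)-z-C_n|<\epsilon\Big)\ \ge\ 1-A\,N\,\frac{\mathbf c^{8/5}}{\epsilon^{11/5}\,[(\sigma-3\epsilon)^{9/5}\wedge 1]}\exp\Big(-A(\sigma,\epsilon,N)\,\frac{\epsilon^2}{\mathbf c}\Big),$$ where $$A(\sigma,\epsilon,N)=\frac{A'}{\log\frac1{\sigma-3\epsilon}+\log(\sigma+N\epsilon)+\frac{\epsilon}{\sigma-\epsilon}}.$$ -/

import Mathlib

open MeasureTheory ProbabilityTheory

noncomputable section

namespace HastingsLevitov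

/-- The exterior unit disk `Δ`. -/
def extDisk : Set ℂ := {z | 1 < ‖z‖}

/-- The length `d(c)` of a slit of capacity `c`: the nonnegative solution of
`e^c = 1 + d² / (4 (1 + d))`; see `exp_eq_slitLength`. -/
def slitLength (c : ℝ) : ℝ :=
  2 * (Real.exp c - 1) + 2 * √(Real.exp c * (Real.exp c - 1))

/-- The Cayley transform, taking `Δ ∪ {∞}` to the right half-plane and `∞` to `1`. -/
def cayley (z : ℂ) : ℂ := (z - 1) / (z + 1)

/-- The image of the point `z` under `f_c`, in the right half-plane (principal square root). -/
def halfPlaneSlit (c : ℝ) (z : ℂ) : ℂ :=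
  ((1 - Real.exp (-c) : ℝ) + (Real.exp (-c) : ℝ) * cayley z ^ 2 : ℂ) ^ (1 / 2 : ℂ)

/-- The slit map `f_c`, the conformal map of `Δ` onto `Δ \ (1, 1 + d(c)]` with
`f_c(z) = e^c z + O(1)` at infinity, in explicit form. That it is this map is proved below:
`differentiableOn_slitMap`, `injOn_slitMap`, `image_slitMap`, `slitMap_isBigO`. -/
def slitMap (c : ℝ) (z : ℂ) : ℂ := (1 + halfPlaneSlit c z) / (1 - halfPlaneSlit c z)

/-- The rotated slit map `z ↦ e^{iθ} f_c(e^{-iθ} z)`. -/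
def rotSlitMap (c θ : ℝ) (z : ℂ) : ℂ :=
  Complex.exp (θ * Complex.I) * slitMap c (Complex.exp (-(θ * Complex.I)) * z)

/-- The cluster map `Φ_n = f_1 ∘ ⋯ ∘ f_n`, with `Φ_0 = id`. The sequences are indexed from `0`:
the `(k+1)`-st particle has capacity `c k` and angle `θ k`. -/
def clusterMap (c θ : ℕ → ℝ) : ℕ → ℂ → ℂ
  | 0 => id
  | n + 1 => clusterMap c θ n ∘ rotSlitMap (c n) (θ n)

/-- The total capacity `C_n = c_1 + ⋯ + c_n`. -/
def totalCap (c : ℕ → ℝ) (n : ℕ) : ℝ := ∑ k ∈ Finset.range n, c k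

/-- The slit map in logarithmic coordinates, `log f_c(e^z)`, with the branch of the logarithm
for which it is `z + c + o(1)` as `Re z → ∞`. -/
def logSlitMap (c : ℝ) (z : ℂ) : ℂ := z + Complex.log (slitMap c (Complex.exp z) / Complex.exp z)

/-- The rotated slit map in logarithmic coordinates. -/
def logRotSlitMap (c θ : ℝ) (z : ℂ) : ℂ := θ * Complex.I + logSlitMap c (z - θ * Complex.I)

/-- The cluster map in logarithmic coordinates, `Φ̃_n(z) = log Φ_n(e^z)`, with the branch of the
logarithm for which it is `z + C_n + o(1)` as `Re z → ∞`; see `exp_logClusterMap`,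
`differentiableOn_logClusterMap` and `tendsto_logClusterMap`, which determine it. -/
def logClusterMap (c θ : ℕ → ℝ) : ℕ → ℂ → ℂ
  | 0 => id
  | n + 1 => logClusterMap c θ n ∘ logRotSlitMap (c n) (θ n)

lemma slitLength_nonneg {c : ℝ} (hc : 0 ≤ c) : 0 ≤ slitLength c := by
  have := Real.one_le_exp hc
  unfold slitLength
  have := Real.sqrt_nonneg (Real.exp c * (Real.exp c - 1))
  linarith

lemma exp_eq_slitLength {c : ℝ} (hc : 0 ≤ c) :
    Real.exp c = 1 + slitLength c ^ 2 / (4 * (1 + slitLength c)) := by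
  have h0 := slitLength_nonneg hc
  have h1 := Real.one_le_exp hc
  have h2 : √(Real.exp c * (Real.exp c - 1)) ^ 2 = Real.exp c * (Real.exp c - 1) :=
    Real.sq_sqrt (by nlinarith)
  have h3 : slitLength c ^ 2 = (Real.exp c - 1) * (4 * (1 + slitLength c)) := by
    unfold slitLength
    linear_combination 4 * h2
  rw [h3, mul_div_assoc, div_self (by positivity)]
  ring

lemma add_one_ne {z : ℂ} (hz : z ∈ extDisk) : z + 1 ≠ 0 := by
  intro h
  have : z = -1 := by linear_combination h
  simp [extDisk, this] at hz

lemma cayley_re_pos {z : ℂ} (hz : z ∈ extDisk) : 0 < (cayley z).re := by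
  have h1 := Complex.normSq_pos.2 (add_one_ne hz)
  have h2 : 1 < z.re * z.re + z.im * z.im := by
    rw [← Complex.normSq_apply, Complex.normSq_eq_norm_sq]
    have : 1 < ‖z‖ := hz
    nlinarith
  unfold cayley
  rw [Complex.div_re, ← add_div]
  apply div_pos _ h1
  simp
  nlinarith

lemma cayley_im {z : ℂ} : (cayley z).im = 2 * z.im / Complex.normSq (z + 1) := by
  unfold cayley
  rw [Complex.div_im, ← sub_div]
  congr 1
  simp
  ring

lemma mem_extDisk_of_re_pos {t : ℂ} (h : 0 < t.re) (h1 : t ≠ 1) : (1 + t) / (1 - t) ∈ extDisk := by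
  have h2 : 0 < ‖1 - t‖ := norm_pos_iff.2 (sub_ne_zero.2 (Ne.symm h1))
  show 1 < ‖(1 + t) / (1 - t)‖
  rw [norm_div, one_lt_div h2]
  apply lt_of_pow_lt_pow_left₀ 2 (norm_nonneg _)
  rw [← Complex.normSq_eq_norm_sq, ← Complex.normSq_eq_norm_sq, Complex.normSq_apply,
    Complex.normSq_apply]
  simp
  nlinarith

lemma sq_mem_slitPlane {t : ℂ} (h : 0 < t.re) : t ^ 2 ∈ Complex.slitPlane := by
  rw [Complex.mem_slitPlane_iff]
  by_cases h1 : t.im = 0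
  · left
    simp [pow_two, h1]
    exact h.ne'
  · right
    simp [pow_two]
    intro h2
    have : t.re * t.im = 0 := by linarith
    rcases mul_eq_zero.1 this with h3 | h3
    · exact h.ne' h3
    · exact h1 h3

lemma affine_mem_slitPlane {a b : ℝ} (ha : 0 ≤ a) (hb : 0 < b) {u : ℂ}
    (hu : u ∈ Complex.slitPlane) : (a + b * u : ℂ) ∈ Complex.slitPlane := by
  rw [Complex.mem_slitPlane_iff] at hu ⊢
  rcases hu with h | h
  · left
    simp
    positivity
  · right
    simp
    exact ⟨hb.ne', h⟩

lemma one_sub_exp_nonneg {c : ℝ} (hc : 0 ≤ c) : 0 ≤ 1 - Real.exp (-c) := by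
  have : Real.exp (-c) ≤ 1 := Real.exp_le_one_iff.2 (by linarith)
  linarith

lemma base_mem_slitPlane {c : ℝ} (hc : 0 ≤ c) {z : ℂ} (hz : z ∈ extDisk) :
    ((1 - Real.exp (-c) : ℝ) + (Real.exp (-c) : ℝ) * cayley z ^ 2 : ℂ) ∈ Complex.slitPlane :=
  affine_mem_slitPlane (one_sub_exp_nonneg hc) (Real.exp_pos _)
    (sq_mem_slitPlane (cayley_re_pos hz))

lemma sqrt_re_pos {u : ℂ} (hu : u ∈ Complex.slitPlane) : 0 < (u ^ (1 / 2 : ℂ)).re := by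
  have h0 := Complex.slitPlane_ne_zero hu
  rw [Complex.cpow_def_of_ne_zero h0, Complex.exp_re]
  apply mul_pos (Real.exp_pos _)
  apply Real.cos_pos_of_mem_Ioo
  have h1 := Complex.neg_pi_lt_arg u
  have h2 := (Complex.arg_le_pi u).lt_of_ne (Complex.mem_slitPlane_iff_arg.1 hu).1
  have : (Complex.log u * (1 / 2)).im = u.arg / 2 := by
    simp [Complex.mul_im, Complex.log_im]
    ring
  rw [this]
  constructor <;> linarith

lemma sqrt_sq (u : ℂ) : (u ^ (1 / 2 : ℂ)) ^ 2 = u := by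
  rw [one_div]
  exact_mod_cast Complex.cpow_nat_inv_pow u two_ne_zero

lemma eq_of_sq_eq {s t : ℂ} (hs : 0 < s.re) (ht : 0 < t.re) (h : s ^ 2 = t ^ 2) : s = t := by
  rcases sq_eq_sq_iff_eq_or_eq_neg.1 h with h | h
  · exact h
  · rw [h] at hs
    simp at hs
    linarith

lemma halfPlaneSlit_sq (c : ℝ) (z : ℂ) : halfPlaneSlit c z ^ 2 =
    ((1 - Real.exp (-c) : ℝ) + (Real.exp (-c) : ℝ) * cayley z ^ 2 : ℂ) := sqrt_sq _

lemma halfPlaneSlit_re_pos {c : ℝ} (hc : 0 ≤ c) {z : ℂ} (hz : z ∈ extDisk) :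
    0 < (halfPlaneSlit c z).re := sqrt_re_pos (base_mem_slitPlane hc hz)

lemma cayley_ne_one {z : ℂ} (hz : z ∈ extDisk) : cayley z ≠ 1 := by
  unfold cayley
  rw [Ne, div_eq_one_iff_eq (add_one_ne hz)]
  intro h
  have h2 : (2 : ℂ) = 0 := by linear_combination -h
  norm_num at h2

lemma halfPlaneSlit_ne_one {c : ℝ} {z : ℂ} (hz : z ∈ extDisk) :
    halfPlaneSlit c z ≠ 1 := by
  intro h
  have h1 := halfPlaneSlit_sq c z
  rw [h] at h1
  have he : (Real.exp (-c) : ℂ) ≠ 0 := by exact_mod_cast (Real.exp_pos _).ne'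
  have h2 : cayley z ^ 2 = 1 ^ 2 := by
    apply mul_left_cancel₀ he
    push_cast at h1 ⊢
    linear_combination -h1
  exact cayley_ne_one hz (eq_of_sq_eq (cayley_re_pos hz) (by simp) h2)

lemma slitMap_mem {c : ℝ} (hc : 0 ≤ c) {z : ℂ} (hz : z ∈ extDisk) : slitMap c z ∈ extDisk :=
  mem_extDisk_of_re_pos (halfPlaneSlit_re_pos hc hz) (halfPlaneSlit_ne_one hz)

lemma differentiableOn_slitMap {c : ℝ} (hc : 0 ≤ c) :
    DifferentiableOn ℂ (slitMap c) extDisk := by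
  intro z hz
  apply DifferentiableAt.differentiableWithinAt
  have h1 : DifferentiableAt ℂ cayley z := by
    unfold cayley
    exact DifferentiableAt.div (by fun_prop) (by fun_prop) (add_one_ne hz)
  have h2 : DifferentiableAt ℂ (halfPlaneSlit c) z := by
    unfold halfPlaneSlit
    exact DifferentiableAt.cpow (by fun_prop) (by fun_prop) (base_mem_slitPlane hc hz)
  unfold slitMap
  exact DifferentiableAt.div (by fun_prop) (by fun_prop)
    (sub_ne_zero.2 (halfPlaneSlit_ne_one hz).symm)

lemma injOn_slitMap {c : ℝ} : Set.InjOn (slitMap c) extDisk := by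
  intro z hz w hw h
  have hz1 := sub_ne_zero.2 (halfPlaneSlit_ne_one (c := c) hz).symm
  have hw1 := sub_ne_zero.2 (halfPlaneSlit_ne_one (c := c) hw).symm
  unfold slitMap at h
  rw [div_eq_div_iff hz1 hw1] at h
  have h1 : halfPlaneSlit c z = halfPlaneSlit c w := by linear_combination h / 2
  have h2 : cayley z ^ 2 = cayley w ^ 2 := by
    have he : (Real.exp (-c) : ℂ) ≠ 0 := by exact_mod_cast (Real.exp_pos _).ne'
    apply mul_left_cancel₀ he
    have h3 := halfPlaneSlit_sq c z
    rw [h1, halfPlaneSlit_sq c w] at h3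
    linear_combination -h3
  have h3 := eq_of_sq_eq (cayley_re_pos hz) (cayley_re_pos hw) h2
  unfold cayley at h3
  rw [div_eq_div_iff (add_one_ne hz) (add_one_ne hw)] at h3
  linear_combination h3 / 2

/-- The slit `(1, 1 + d(c)]`. -/
def slit (c : ℝ) : Set ℂ := (fun x : ℝ => (x : ℂ)) '' Set.Ioc 1 (1 + slitLength c)

/-- A real number `s ∈ [0, 1)` corresponds to a point of the closed slit iff
`s² ≤ 1 - e^{-c}`. -/
lemma real_slit_iff {c : ℝ} (hc : 0 ≤ c) {s : ℝ} (hs : 0 ≤ s) (hs1 : s < 1) :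
    (1 + s) / (1 - s) ≤ 1 + slitLength c ↔ s ^ 2 ≤ 1 - Real.exp (-c) := by
  have he := Real.exp_pos (-c)
  have ha0 : 0 ≤ 1 - Real.exp (-c) := one_sub_exp_nonneg hc
  obtain ⟨a, ha⟩ : ∃ a, a = √(1 - Real.exp (-c)) := ⟨_, rfl⟩
  have ha1 : 0 ≤ a := ha ▸ Real.sqrt_nonneg _
  have ha2 : a ^ 2 = 1 - Real.exp (-c) := by rw [ha]; exact Real.sq_sqrt ha0
  have ha3 : a < 1 := by nlinarith
  have hE : Real.exp c * Real.exp (-c) = 1 := by rw [← Real.exp_add]; simp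
  have hE' : Real.exp c * (1 - a ^ 2) = 1 := by rw [ha2]; linarith
  have hpos := Real.exp_pos c
  have hsq : √(Real.exp c * (Real.exp c - 1)) = Real.exp c * a := by
    rw [Real.sqrt_eq_iff_eq_sq (by nlinarith [Real.one_le_exp hc]) (by positivity)]
    have : Real.exp c * a ^ 2 = Real.exp c - 1 := by linarith
    linear_combination -Real.exp c * this
  have hd : 1 + slitLength c = (1 + a) / (1 - a) := by
    rw [eq_div_iff (by linarith)]
    unfold slitLength
    rw [hsq]
    linear_combination 2 * hE'
  rw [hd, div_le_div_iff₀ (by linarith) (by linarith), ← ha2]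
  constructor
  · intro h
    have : s ≤ a := by linarith
    exact pow_le_pow_left₀ hs this 2
  · intro h
    have : s ≤ a := le_of_sq_le_sq h ha1
    nlinarith

lemma image_slitMap {c : ℝ} (hc : 0 ≤ c) : slitMap c '' extDisk = extDisk \ slit c := by
  have he := Real.exp_pos (-c)
  have heC : (Real.exp (-c) : ℂ) ≠ 0 := by exact_mod_cast he.ne'
  ext w
  constructor
  · rintro ⟨z, hz, rfl⟩
    refine ⟨slitMap_mem hc hz, ?_⟩
    rintro ⟨x, ⟨hx1, hx2⟩, hx⟩
    have hS1 := sub_ne_zero.2 (halfPlaneSlit_ne_one (c := c) hz).symm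
    simp only at hx
    unfold slitMap at hx
    rw [eq_div_iff hS1] at hx
    have hx0 : (x : ℂ) + 1 ≠ 0 := by
      have : x + 1 ≠ 0 := by linarith
      exact_mod_cast this
    have hS : halfPlaneSlit c z = ((x - 1) / (x + 1) : ℝ) := by
      push_cast
      rw [eq_div_iff hx0]
      linear_combination -hx
    have hs0 : 0 ≤ (x - 1) / (x + 1) := div_nonneg (by linarith) (by linarith)
    have hs1 : (x - 1) / (x + 1) < 1 := by rw [div_lt_one (by linarith)]; linarith
    have hxx : (1 + (x - 1) / (x + 1)) / (1 - (x - 1) / (x + 1)) = x := by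
      have : x + 1 ≠ 0 := by linarith
      field_simp
      ring
    have hle := (real_slit_iff hc hs0 hs1).1 (by rw [hxx]; exact hx2)
    have hsq := halfPlaneSlit_sq c z
    rw [hS] at hsq
    have ht : cayley z ^ 2 =
        (((((x - 1) / (x + 1)) ^ 2 - (1 - Real.exp (-c))) / Real.exp (-c) : ℝ) : ℂ) := by
      rw [Complex.ofReal_div, eq_div_iff heC]
      push_cast at hsq ⊢
      linear_combination -hsq
    have hp := sq_mem_slitPlane (cayley_re_pos hz)
    rw [ht, Complex.ofReal_mem_slitPlane] at hp
    have := div_nonpos_of_nonpos_of_nonneg (sub_nonpos.2 hle) he.le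
    linarith
  · rintro ⟨hw, hws⟩
    have hS0 := cayley_re_pos hw
    have hS1 := cayley_ne_one hw
    have hwS : (1 + cayley w) / (1 - cayley w) = w := by
      rw [div_eq_iff (sub_ne_zero.2 hS1.symm)]
      unfold cayley
      have := add_one_ne hw
      field_simp
      ring
    obtain ⟨u, hu⟩ : ∃ u : ℂ, u = (cayley w ^ 2 - (1 - Real.exp (-c) : ℝ)) / (Real.exp (-c) : ℝ) :=
      ⟨_, rfl⟩
    have hu' : ((1 - Real.exp (-c) : ℝ) + (Real.exp (-c) : ℝ) * u : ℂ) = cayley w ^ 2 := by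
      rw [hu]
      field_simp
      ring
    have husl : u ∈ Complex.slitPlane := by
      by_contra hn
      rw [Complex.mem_slitPlane_iff] at hn
      push Not at hn
      have hre := congrArg Complex.re hu'
      have him := congrArg Complex.im hu'
      simp [pow_two, hn.2, -Complex.ofReal_exp] at hre him
      have him0 : (cayley w).im = 0 := by
        have h3 : (cayley w).re * (cayley w).im = 0 := by linarith
        rcases mul_eq_zero.1 h3 with h3 | h3
        · exact absurd h3 hS0.ne'
        · exact h3
      rw [him0] at hre
      have hle : (cayley w).re ^ 2 ≤ 1 - Real.exp (-c) := by
        have := mul_nonpos_of_nonneg_of_nonpos he.le hn.1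
        nlinarith
      have hlt : (cayley w).re < 1 := by nlinarith
      have hreal : cayley w = ((cayley w).re : ℂ) := by
        apply Complex.ext <;> simp [him0]
      apply hws
      refine ⟨(1 + (cayley w).re) / (1 - (cayley w).re), ⟨?_, ?_⟩, ?_⟩
      · rw [one_lt_div (by linarith)]
        linarith
      · exact (real_slit_iff hc hS0.le hlt).2 hle
      · push_cast
        rw [← hreal, hwS]
    have ht0 := sqrt_re_pos husl
    have ht2 := sqrt_sq u
    obtain ⟨t, ht⟩ : ∃ t, t = u ^ (1 / 2 : ℂ) := ⟨_, rfl⟩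
    rw [← ht] at ht0 ht2
    have ht1 : t ≠ 1 := by
      intro h
      rw [h] at ht2
      rw [← ht2] at hu'
      push_cast at hu'
      exact hS1 (eq_of_sq_eq hS0 (by simp) (by linear_combination -hu'))
    have htn := sub_ne_zero.2 ht1.symm
    refine ⟨(1 + t) / (1 - t), mem_extDisk_of_re_pos ht0 ht1, ?_⟩
    have hct : cayley ((1 + t) / (1 - t)) = t := by
      unfold cayley
      field_simp
      ring
    have hh : halfPlaneSlit c ((1 + t) / (1 - t)) = cayley w := by
      apply eq_of_sq_eq (halfPlaneSlit_re_pos hc (mem_extDisk_of_re_pos ht0 ht1)) hS0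
      rw [halfPlaneSlit_sq, hct, ht2, hu']
    unfold slitMap
    rw [hh, hwS]

lemma norm_slitMap_sub_le {c : ℝ} (hc : 0 ≤ c) {z : ℂ} (hz : 2 ≤ ‖z‖) :
    ‖slitMap c z - Real.exp c * z‖ ≤ 30 * Real.exp c := by
  have hzD : z ∈ extDisk := by
    show 1 < ‖z‖
    linarith
  have he := Real.exp_pos (-c)
  have heC : (Real.exp (-c) : ℂ) ≠ 0 := by exact_mod_cast he.ne'
  have hE : (Real.exp c : ℂ) * (Real.exp (-c) : ℝ) = 1 := by
    rw [← Complex.ofReal_mul, ← Real.exp_add]; simp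
  have hz1 := add_one_ne hzD
  have hz0 : z ≠ 0 := by
    intro h
    simp [h] at hz
    linarith
  have hS1 := sub_ne_zero.2 (halfPlaneSlit_ne_one (c := c) hzD).symm
  have hS0 := halfPlaneSlit_re_pos hc hzD
  have hsq := halfPlaneSlit_sq c z
  obtain ⟨S, hS⟩ : ∃ S, S = halfPlaneSlit c z := ⟨_, rfl⟩
  have hmap : slitMap c z = (1 + S) / (1 - S) := by rw [hS]; rfl
  rw [← hS] at hS1 hS0 hsq
  have hn1 : 1 ≤ ‖1 + S‖ := by
    refine le_trans ?_ (Complex.re_le_norm _)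
    simp
    linarith
  have hn : 1 + S ≠ 0 := by
    intro h
    rw [h] at hn1
    simp at hn1
    linarith
  have hc4 : (1 - cayley z ^ 2) * (z + 1) ^ 2 = 4 * z := by
    unfold cayley
    field_simp
    ring
  have hkey : (1 - S) * (1 + S) * (z + 1) ^ 2 = (Real.exp (-c) : ℝ) * (4 * z) := by
    rw [← hc4]
    push_cast at hsq ⊢
    linear_combination -(z + 1) ^ 2 * hsq
  have hz1n : ‖z‖ / 2 ≤ ‖z + 1‖ := by
    have := norm_sub_le (z + 1) 1
    simp at this
    linarith
  have hz1p : 0 < ‖z + 1‖ := norm_pos_iff.2 hz1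
  have hdel : ‖(1 - S) * (z + 1)‖ ≤ 8 := by
    have h1 := congrArg norm hkey
    rw [norm_mul, norm_mul, norm_pow, norm_mul, norm_mul, Complex.norm_real,
      Real.norm_of_nonneg he.le] at h1
    have h4 : ‖(4 : ℂ)‖ = 4 := by simp
    rw [h4] at h1
    have h2 : Real.exp (-c) ≤ 1 := by
      have := one_sub_exp_nonneg hc
      linarith
    rw [norm_mul]
    have h3 : ‖1 - S‖ * ‖z + 1‖ ^ 2 ≤ 8 * ‖z + 1‖ := by
      calc ‖1 - S‖ * ‖z + 1‖ ^ 2 ≤ ‖1 - S‖ * ‖1 + S‖ * ‖z + 1‖ ^ 2 := by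
            have : ‖1 - S‖ * 1 ≤ ‖1 - S‖ * ‖1 + S‖ := by gcongr
            nlinarith [sq_nonneg ‖z + 1‖]
        _ = Real.exp (-c) * (4 * ‖z‖) := h1
        _ ≤ 1 * (4 * ‖z‖) := by gcongr
        _ ≤ 8 * ‖z + 1‖ := by linarith
    nlinarith
  have hform : slitMap c z - Real.exp c * z =
      Real.exp c * ((2 - (1 - S) * (z + 1)) * (4 * z + (2 - (1 - S) * (z + 1)))) / (4 * z) := by
    have h1 : slitMap c z = Real.exp c * ((1 + S) * (z + 1)) ^ 2 / (4 * z) := by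
      rw [hmap, div_eq_div_iff hS1 (by simpa using hz0)]
      linear_combination (-(1 + S) * Real.exp c) * hkey - (1 + S) * 4 * z * hE
    rw [h1]
    field_simp
    ring
  obtain ⟨D, hD⟩ : ∃ D, D = 2 - (1 - S) * (z + 1) := ⟨_, rfl⟩
  have hDn : ‖D‖ ≤ 10 := by
    rw [hD]
    refine (norm_sub_le _ _).trans ?_
    simp only [Complex.norm_ofNat]
    linarith
  rw [hform, ← hD, norm_div, norm_mul, Complex.norm_real, Real.norm_of_nonneg (Real.exp_pos c).le,
    norm_mul, norm_mul, Complex.norm_ofNat, div_le_iff₀ (by linarith)]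
  have h5 : ‖4 * z + D‖ ≤ 4 * ‖z‖ + 10 := by
    refine (norm_add_le _ _).trans ?_
    rw [norm_mul, Complex.norm_ofNat]
    linarith
  have h6 : ‖D‖ * ‖4 * z + D‖ ≤ 10 * (4 * ‖z‖ + 10) := by gcongr
  nlinarith [Real.exp_pos c]

/-- `f_c(z) = e^c z + O(1)` at infinity. -/
lemma slitMap_isBigO {c : ℝ} (hc : 0 ≤ c) :
    (fun z : ℂ => slitMap c z - Real.exp c * z) =O[Bornology.cobounded ℂ] (fun _ => (1 : ℝ)) := by
  refine Asymptotics.IsBigO.of_bound (30 * Real.exp c) ?_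
  filter_upwards [tendsto_norm_cobounded_atTop.eventually_ge_atTop (2 : ℝ)] with z hz
  simpa using norm_slitMap_sub_le hc hz

lemma exp_mem_extDisk {z : ℂ} : Complex.exp z ∈ extDisk ↔ 0 < z.re := by
  show 1 < ‖Complex.exp z‖ ↔ _
  rw [Complex.norm_exp, Real.one_lt_exp_iff]

lemma ne_zero_of_mem {z : ℂ} (hz : z ∈ extDisk) : z ≠ 0 := by
  rintro rfl
  simp [extDisk] at hz
  linarith

lemma exp_logSlitMap {c : ℝ} (hc : 0 ≤ c) {z : ℂ} (hz : 0 < z.re) :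
    Complex.exp (logSlitMap c z) = slitMap c (Complex.exp z) := by
  have h := ne_zero_of_mem (slitMap_mem hc (exp_mem_extDisk.2 hz))
  unfold logSlitMap
  rw [Complex.exp_add, Complex.exp_log (div_ne_zero h (Complex.exp_ne_zero z)),
    mul_div_cancel₀ _ (Complex.exp_ne_zero z)]

lemma logSlitMap_re_pos {c : ℝ} (hc : 0 ≤ c) {z : ℂ} (hz : 0 < z.re) :
    0 < (logSlitMap c z).re := by
  rw [← exp_mem_extDisk, exp_logSlitMap hc hz]
  exact slitMap_mem hc (exp_mem_extDisk.2 hz)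

lemma logRotSlitMap_re_pos {c θ : ℝ} (hc : 0 ≤ c) {z : ℂ} (hz : 0 < z.re) :
    0 < (logRotSlitMap c θ z).re := by
  unfold logRotSlitMap
  have := logSlitMap_re_pos (z := z - θ * Complex.I) hc (by simpa using hz)
  simpa using this

lemma exp_logRotSlitMap {c θ : ℝ} (hc : 0 ≤ c) {z : ℂ} (hz : 0 < z.re) :
    Complex.exp (logRotSlitMap c θ z) = rotSlitMap c θ (Complex.exp z) := by
  unfold logRotSlitMap rotSlitMap
  rw [Complex.exp_add, exp_logSlitMap hc (by simpa using hz), ← Complex.exp_add]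
  congr 3
  ring

/-- `Φ̃_n` is a logarithm of `Φ_n(e^z)`. -/
lemma exp_logClusterMap {c : ℕ → ℝ} (hc : ∀ k, 0 ≤ c k) (θ : ℕ → ℝ) (n : ℕ) {z : ℂ}
    (hz : 0 < z.re) :
    Complex.exp (logClusterMap c θ n z) = clusterMap c θ n (Complex.exp z) := by
  induction n generalizing z with
  | zero => rfl
  | succ n ih =>
    simp only [logClusterMap, clusterMap, Function.comp_apply]
    rw [ih (logRotSlitMap_re_pos (hc n) hz), exp_logRotSlitMap (hc n) hz]

lemma slitMap_div_mem_slitPlane {c : ℝ} (hc : 0 ≤ c) {z : ℂ} (hz : z ∈ extDisk) :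
    slitMap c z / z ∈ Complex.slitPlane := by
  have he := Real.exp_pos (-c)
  have hz0 := ne_zero_of_mem hz
  have ht0 := cayley_re_pos hz
  have hS0 := halfPlaneSlit_re_pos hc hz
  have hS1 := sub_ne_zero.2 (halfPlaneSlit_ne_one (c := c) hz).symm
  have hsq := halfPlaneSlit_sq c z
  have hN := Complex.normSq_pos.2 hS1
  have hM := Complex.normSq_pos.2 (add_one_ne hz)
  have hre := congrArg Complex.re hsq
  have him := congrArg Complex.im hsq
  simp [pow_two, -Complex.ofReal_exp] at hre him
  have htim := cayley_im (z := z)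
  obtain ⟨S, hS⟩ : ∃ S, S = halfPlaneSlit c z := ⟨_, rfl⟩
  have hmap : slitMap c z = (1 + S) / (1 - S) := by rw [hS]; rfl
  rw [← hS] at hS0 hN hre him
  have hwim : (slitMap c z).im * Complex.normSq (1 - S) = 2 * S.im := by
    rw [hmap, Complex.div_im, ← sub_div, div_mul_cancel₀ _ hN.ne']
    simp
    ring
  have hwre : (slitMap c z).re * Complex.normSq (1 - S) = 1 - S.re ^ 2 - S.im ^ 2 := by
    rw [hmap, Complex.div_re, ← add_div, div_mul_cancel₀ _ hN.ne']
    simp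
    ring
  by_contra hq
  rw [Complex.mem_slitPlane_iff] at hq
  push Not at hq
  obtain ⟨q, hqd⟩ : ∃ q, q = slitMap c z / z := ⟨_, rfl⟩
  rw [← hqd] at hq
  have hw : slitMap c z = q * z := by rw [hqd, div_mul_cancel₀ _ hz0]
  have hw1 : (slitMap c z).re = q.re * z.re := by rw [hw]; simp [hq.2]
  have hw2 : (slitMap c z).im = q.re * z.im := by rw [hw]; simp [hq.2]
  have hti : (cayley z).im * Complex.normSq (z + 1) = 2 * z.im := by
    rw [htim, div_mul_cancel₀ _ hM.ne']
  have him' : S.re * S.im = Real.exp (-c) * ((cayley z).re * (cayley z).im) := by linarith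
  by_cases hzi : z.im = 0
  · have hti0 : (cayley z).im = 0 := by rw [htim, hzi]; simp
    have hSi : S.im = 0 := by
      rw [hti0] at him'
      simpa [hS0.ne'] using him'
    have hzr : z = (z.re : ℂ) := by apply Complex.ext <;> simp [hzi]
    have hz1 : 1 < |z.re| := by
      have h1 : 1 < ‖z‖ := hz
      rw [hzr, Complex.norm_real] at h1
      simpa using h1
    have hx1 : z.re + 1 ≠ 0 := by
      intro h
      rw [show z.re = -1 by linarith] at hz1
      simp at hz1
    have htr : (cayley z).re * (z.re + 1) = z.re - 1 := by
      have h1 : cayley z * (z + 1) = z - 1 := div_mul_cancel₀ _ (add_one_ne hz)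
      have h2 := congrArg Complex.re h1
      simpa [hzi] using h2
    rw [hti0, hSi] at hre
    rw [hSi, pow_two] at hwre
    have hpos : 0 < (slitMap c z).re * z.re := by
      rcases lt_abs.1 hz1 with h | h
      · have h1 : (cayley z).re < 1 := by nlinarith only [htr, h]
        have h2 : (cayley z).re * (cayley z).re < 1 := by nlinarith only [h1, ht0]
        have h3 : S.re * S.re < 1 := by
          have := mul_lt_mul_of_pos_left h2 he
          linarith
        have h4 : 0 < (slitMap c z).re := by
          apply pos_of_mul_pos_left _ hN.le
          rw [hwre]
          linarith
        exact mul_pos h4 (by linarith)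
      · have h1 : 1 < (cayley z).re := by nlinarith only [htr, h]
        have h2 : 1 < (cayley z).re * (cayley z).re := by nlinarith only [h1]
        have h3 : 1 < S.re * S.re := by
          have := mul_lt_mul_of_pos_left h2 he
          linarith
        have h4 : (slitMap c z).re < 0 := by
          by_contra h5
          have := mul_nonneg (not_lt.1 h5) hN.le
          rw [hwre] at this
          linarith
        exact mul_pos_of_neg_of_neg h4 (by linarith)
    rw [hw1] at hpos
    nlinarith only [hpos, mul_nonneg (neg_nonneg.2 hq.1) (mul_self_nonneg z.re)]
  · have h1 : 0 < S.im * z.im := by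
      have h2 : 0 < (cayley z).im * z.im := by
        rw [htim, div_mul_eq_mul_div]
        apply div_pos _ hM
        have := mul_self_pos.2 hzi
        linarith
      have h3 : S.re * (S.im * z.im) =
          Real.exp (-c) * ((cayley z).re * ((cayley z).im * z.im)) := by
        linear_combination z.im * him'
      have h4 : 0 < S.re * (S.im * z.im) := by rw [h3]; positivity
      exact pos_of_mul_pos_right h4 hS0.le
    have h2 : 0 < (slitMap c z).im * z.im := by
      have h3 : 0 < ((slitMap c z).im * z.im) * Complex.normSq (1 - S) := by
        have : ((slitMap c z).im * z.im) * Complex.normSq (1 - S) = 2 * (S.im * z.im) := by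
          linear_combination z.im * hwim
        linarith
      exact pos_of_mul_pos_left h3 hN.le
    rw [hw2] at h2
    nlinarith only [h2, mul_nonneg (neg_nonneg.2 hq.1) (mul_self_nonneg z.im)]

lemma isOpen_extDisk : IsOpen extDisk := isOpen_lt continuous_const continuous_norm

lemma differentiableAt_logSlitMap {c : ℝ} (hc : 0 ≤ c) {z : ℂ} (hz : 0 < z.re) :
    DifferentiableAt ℂ (logSlitMap c) z := by
  have hm := exp_mem_extDisk.2 hz
  have h1 : DifferentiableAt ℂ (slitMap c) (Complex.exp z) :=
    (differentiableOn_slitMap hc).differentiableAt (isOpen_extDisk.mem_nhds hm)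
  have h2 : DifferentiableAt ℂ (fun w => slitMap c (Complex.exp w)) z :=
    h1.comp z Complex.differentiable_exp.differentiableAt
  unfold logSlitMap
  exact differentiableAt_id.add
    ((h2.div Complex.differentiable_exp.differentiableAt (Complex.exp_ne_zero z)).clog
      (slitMap_div_mem_slitPlane hc hm))

/-- `Φ̃_n` is holomorphic on the right half-plane. -/
lemma differentiableOn_logClusterMap {c : ℕ → ℝ} (hc : ∀ k, 0 ≤ c k) (θ : ℕ → ℝ) (n : ℕ) :
    DifferentiableOn ℂ (logClusterMap c θ n) {z | 0 < z.re} := by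
  induction n with
  | zero => exact differentiableOn_id
  | succ n ih =>
    refine DifferentiableOn.comp ih ?_ (fun z hz => logRotSlitMap_re_pos (hc n) hz)
    intro z hz
    apply DifferentiableAt.differentiableWithinAt
    unfold logRotSlitMap
    have h1 : DifferentiableAt ℂ (logSlitMap (c n)) (z - θ n * Complex.I) :=
      differentiableAt_logSlitMap (hc n) (by simpa using hz)
    have h2 : DifferentiableAt ℂ (fun w : ℂ => w - θ n * Complex.I) z := by fun_prop
    exact (differentiableAt_const _).add
      (DifferentiableAt.comp (g := logSlitMap (c n)) z h1 h2)

lemma tendsto_slitMap_div {c : ℝ} (hc : 0 ≤ c) :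
    Filter.Tendsto (fun z => slitMap c z / z) (Bornology.cobounded ℂ)
      (nhds (Real.exp c : ℂ)) := by
  rw [tendsto_iff_norm_sub_tendsto_zero]
  have h1 : Filter.Tendsto (fun z : ℂ => 30 * Real.exp c / ‖z‖) (Bornology.cobounded ℂ)
      (nhds 0) := tendsto_const_nhds.div_atTop tendsto_norm_cobounded_atTop
  refine squeeze_zero' (Filter.Eventually.of_forall fun _ => norm_nonneg _) ?_ h1
  filter_upwards [tendsto_norm_cobounded_atTop.eventually_ge_atTop (2 : ℝ)] with z hz
  have hz0 : z ≠ 0 := by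
    rintro rfl
    simp at hz
    linarith
  have h2 : slitMap c z / z - Real.exp c = (slitMap c z - Real.exp c * z) / z := by
    field_simp
  rw [h2, norm_div]
  gcongr
  exact norm_slitMap_sub_le hc hz

lemma tendsto_logSlitMap {c : ℝ} (hc : 0 ≤ c) :
    Filter.Tendsto (fun z => logSlitMap c z - z) (Filter.comap Complex.re Filter.atTop)
      (nhds (c : ℂ)) := by
  have h1 := (tendsto_slitMap_div hc).comp Complex.tendsto_exp_comap_re_atTop
  have h2 := h1.clog (by
    rw [Complex.ofReal_mem_slitPlane]
    exact Real.exp_pos c)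
  rw [← Complex.ofReal_log (Real.exp_pos c).le, Real.log_exp] at h2
  refine h2.congr fun z => ?_
  simp [logSlitMap]

/-- `Φ̃_n(z) - z → C_n` as `Re z → ∞`. -/
lemma tendsto_logClusterMap {c : ℕ → ℝ} (hc : ∀ k, 0 ≤ c k) (θ : ℕ → ℝ) (n : ℕ) :
    Filter.Tendsto (fun z => logClusterMap c θ n z - z) (Filter.comap Complex.re Filter.atTop)
      (nhds (totalCap c n : ℂ)) := by
  induction n with
  | zero => simpa [logClusterMap, totalCap] using tendsto_const_nhds
  | succ n ih =>
    have hr : Filter.Tendsto Complex.re (Filter.comap Complex.re Filter.atTop) Filter.atTop :=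
      Filter.tendsto_comap
    have h0 : Filter.Tendsto (fun z : ℂ => z - θ n * Complex.I)
        (Filter.comap Complex.re Filter.atTop) (Filter.comap Complex.re Filter.atTop) := by
      rw [Filter.tendsto_comap_iff]
      refine hr.congr fun z => ?_
      simp
    have h1 : Filter.Tendsto (fun z => logRotSlitMap (c n) (θ n) z - z)
        (Filter.comap Complex.re Filter.atTop) (nhds (c n : ℂ)) := by
      refine ((tendsto_logSlitMap (hc n)).comp h0).congr fun z => ?_
      simp only [Function.comp_apply, logRotSlitMap]
      ring
    have h2 : Filter.Tendsto (logRotSlitMap (c n) (θ n))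
        (Filter.comap Complex.re Filter.atTop) (Filter.comap Complex.re Filter.atTop) := by
      rw [Filter.tendsto_comap_iff]
      have h3 := (Complex.continuous_re.tendsto _).comp h1
      refine (Filter.Tendsto.add_atTop h3 hr).congr fun z => ?_
      simp
    have h4 := (ih.comp h2).add h1
    have h5 : (totalCap c (n + 1) : ℂ) = totalCap c n + c n := by
      simp [totalCap, Finset.sum_range_succ]
    rw [h5]
    refine h4.congr fun z => ?_
    simp [logClusterMap]

end HastingsLevitov

end

/-!
In logarithmic coordinates `Φ̃_n(z) - z` is a holomorphic function of `e^{-z}` with nonnegative real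
part and value `C_n` at `0`, so the Schwarz lemma controls it near infinity. Composing with one more
slit map adds an increment which, for a uniform angle, has mean zero and mean square zero, and hence
variance of order `c² / (e^x - 1)` at real part `x`. The potential
`log (1 - e^{-(x + T)}) - log (1 - e^{-x})` dominates the variance accumulated while the real part
grows by the capacity `T`, which makes the exponentially tilted fluctuation at a point a
supermartingale. A circle mean of the tilted exponential dominates its supremum over a half-plane,
and the times at which the capacity crosses multiples of a small level control all `n ≤ N`.
With the optimal tilt this gives a tail of order `exp (-a ε² / (c D))`, where `c` bounds the
capacities and `D` is the value of the potential up to a boundary term; the inequality `p ≤ √p` for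
a probability `p` then halves the exponent of the prefactor, which yields the stated powers.
-/

namespace HastingsLevitov

open Filter Topology Metric

section HalfPlane

lemma differentiableOn_cuspFunction {h : ℝ} (hh : 0 < h) {f : ℂ → ℂ} (hf : Function.Periodic f h)
    (hd : ∀ τ : ℂ, 0 < τ.im → DifferentiableAt ℂ f τ)
    (hb : BoundedAtFilter (comap Complex.im atTop) f) :
    DifferentiableOn ℂ (Function.Periodic.cuspFunction h f) (ball 0 1) := by
  intro q hq
  apply DifferentiableAt.differentiableWithinAt
  by_cases hq0 : q = 0
  · rw [hq0]
    exact Function.Periodic.differentiableAt_cuspFunction_zero hh hf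
      ((tendsto_comap.eventually (eventually_gt_atTop 0)).mono hd) hb
  · rw [← Function.Periodic.qParam_right_inv hh.ne' hq0]
    refine Function.Periodic.differentiableAt_cuspFunction hh.ne' hf (hd _ ?_)
    rw [Function.Periodic.im_invQParam]
    have hlog : Real.log ‖q‖ < 0 := Real.log_neg (norm_pos_iff.2 hq0) (by simpa using hq)
    exact mul_pos_of_neg_of_neg (div_neg_of_neg_of_pos (by linarith) (by positivity)) hlog

lemma isOpen_re_pos : IsOpen {z : ℂ | 0 < z.re} := isOpen_lt continuous_const Complex.continuous_re

lemma qParam_two_pi (τ : ℂ) :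
    Function.Periodic.qParam (2 * Real.pi) τ = Complex.exp (Complex.I * τ) := by
  have : (Real.pi : ℂ) ≠ 0 := by exact_mod_cast Real.pi_ne_zero
  rw [Function.Periodic.qParam]
  push_cast
  congr 1
  field_simp

lemma exists_eq_comp_exp_neg {u : ℂ → ℂ} {L : ℂ} (hd : DifferentiableOn ℂ u {z | 0 < z.re})
    (hp : Function.Periodic u (2 * Real.pi * Complex.I))
    (ht : Tendsto u (comap Complex.re atTop) (𝓝 L)) :
    ∃ k : ℂ → ℂ, DifferentiableOn ℂ k (ball 0 1) ∧ k 0 = L ∧ ∀ z, k (Complex.exp (-z)) = u z := by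
  -- `z ↦ I z` turns the right half-plane into the upper one, where the `q`-expansion lives.
  let f : ℂ → ℂ := fun τ => u (-Complex.I * τ)
  have hf : Function.Periodic f ((2 * Real.pi : ℝ) : ℂ) := fun τ => by
    simp only [f]
    rw [← hp (-Complex.I * (τ + (2 * Real.pi : ℝ)))]
    congr 1
    push_cast
    ring
  have hdf (τ : ℂ) (hτ : 0 < τ.im) : DifferentiableAt ℂ f τ :=
    DifferentiableAt.comp (g := u) τ
      (hd.differentiableAt (isOpen_re_pos.mem_nhds (by simpa using hτ))) (by fun_prop)
  have htf : Tendsto f (comap Complex.im atTop) (𝓝 L) :=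
    ht.comp (tendsto_comap_iff.2 (tendsto_comap.congr fun τ => by simp))
  have hbf : BoundedAtFilter (comap Complex.im atTop) f := htf.isBigO_one ℝ
  have : (comap Complex.im atTop).NeBot :=
    comap_neBot_iff_frequently.2 (Frequently.of_forall fun y => ⟨⟨0, y⟩, rfl⟩)
  refine ⟨Function.Periodic.cuspFunction (2 * Real.pi) f,
    differentiableOn_cuspFunction Real.two_pi_pos hf hdf hbf,
    tendsto_nhds_unique (Function.Periodic.tendsto_at_I_inf Real.two_pi_pos hf
      ((tendsto_comap.eventually (eventually_gt_atTop 0)).mono hdf) hbf) htf, fun z => ?_⟩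
  have hz := Function.Periodic.eq_cuspFunction Real.two_pi_pos.ne' hf (Complex.I * z)
  rw [qParam_two_pi, ← mul_assoc, Complex.I_mul_I, neg_one_mul] at hz
  rw [hz]
  simp only [f, ← mul_assoc, neg_mul, Complex.I_mul_I, neg_neg, one_mul]

lemma re_nonneg_of_log_norm_le {k : ℂ → ℂ} (hd : DifferentiableOn ℂ k (ball 0 1))
    (hk : ∀ w ∈ ball (0 : ℂ) 1, w ≠ 0 → Real.log ‖w‖ ≤ (k w).re) {w : ℂ} (hw : w ∈ ball (0 : ℂ) 1) :
    0 ≤ (k w).re := by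
  let g : ℂ → ℂ := fun v => v * Complex.exp (-k v)
  have hdg : DifferentiableOn ℂ g (ball 0 1) := differentiableOn_id.mul hd.neg.cexp
  have hg : Set.MapsTo g (ball 0 1) (closedBall (g 0) 1) := fun v hv => by
    rcases eq_or_ne v 0 with rfl | hv0
    · simp
    · rw [show g 0 = 0 by simp [g], mem_closedBall_zero_iff, norm_mul, Complex.norm_exp,
        Complex.neg_re, ← Real.exp_log (norm_pos_iff.2 hv0), ← Real.exp_add, Real.exp_le_one_iff]
      linarith [hk v hv hv0]
  have hslope : dslope g 0 w = Complex.exp (-k w) := by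
    rcases eq_or_ne w 0 with rfl | hw0
    · have hk0 := (hd.neg.cexp.differentiableAt (isOpen_ball.mem_nhds hw)).hasDerivAt
      simpa [dslope_same] using ((hasDerivAt_id' (0 : ℂ)).fun_mul hk0).deriv
    · simp [dslope_of_ne _ hw0, slope_def_field, g, hw0]
  have hschwarz := Complex.norm_dslope_le_div_of_mapsTo_ball hdg hg hw
  rw [hslope, Complex.norm_exp, div_one, Real.exp_le_one_iff, Complex.neg_re] at hschwarz
  linarith

lemma norm_sub_le_of_re_nonneg {k : ℂ → ℂ} (hd : DifferentiableOn ℂ k (ball 0 1))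
    (hk : ∀ w ∈ ball (0 : ℂ) 1, 0 ≤ (k w).re) {w : ℂ} (hw : w ∈ ball (0 : ℂ) 1) :
    ‖k w - k 0‖ ≤ 2 * (k 0).re * ‖w‖ / (1 - ‖w‖) := by
  have h0 : 0 ≤ (k 0).re := hk 0 (mem_ball_self one_pos)
  have hlt : ∀ M : ℝ, (k 0).re < M → ‖k w - k 0‖ ≤ 2 * M * ‖w‖ / (1 - ‖w‖) := fun M hM => by
    rw [norm_sub_rev]
    refine Complex.borelCaratheodory_zero (f := fun v => k 0 - k v) (h0.trans_lt hM)
      (hd.const_sub _) (fun v hv => ?_) one_pos hw (sub_self _)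
    simp only [Set.mem_ofPred_eq, Complex.sub_re]
    linarith [hk v hv]
  have ht : Tendsto (fun M : ℝ => 2 * M * ‖w‖ / (1 - ‖w‖)) (𝓝[>] (k 0).re)
      (𝓝 (2 * (k 0).re * ‖w‖ / (1 - ‖w‖))) :=
    (Continuous.tendsto (by fun_prop) _).mono_left nhdsWithin_le_nhds
  exact ge_of_tendsto ht (eventually_nhdsWithin_of_forall hlt)

lemma exp_neg_mem_ball {z : ℂ} (hz : 0 < z.re) : Complex.exp (-z) ∈ ball (0 : ℂ) 1 := by
  simpa [Complex.norm_exp] using hz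

lemma exp_neg_div_one_sub_exp_neg (x : ℝ) :
    Real.exp (-x) / (1 - Real.exp (-x)) = 1 / (Real.exp x - 1) := by
  rw [← mul_div_mul_left _ _ (Real.exp_ne_zero x), mul_sub, ← Real.exp_add, add_neg_cancel,
    Real.exp_zero, mul_one]

end HalfPlane

section LogMap

/-- A holomorphic self-map of the right half-plane which commutes with translation by `2πi` and is
`z + T + o(1)` as `Re z → ∞`: the logarithmic coordinate form of a conformal map of the exterior
disk into itself with capacity `T`. -/
structure IsLogMap (H : ℂ → ℂ) (T : ℝ) : Prop where
  differentiableOn : DifferentiableOn ℂ H {z | 0 < z.re}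
  add_period : ∀ z, H (z + 2 * Real.pi * Complex.I) = H z + 2 * Real.pi * Complex.I
  re_pos : ∀ z, 0 < z.re → 0 < (H z).re
  tendsto : Tendsto (fun z => H z - z) (comap Complex.re atTop) (𝓝 (T : ℂ))

namespace IsLogMap

variable {H : ℂ → ℂ} {T : ℝ} {z : ℂ}

lemma exists_herglotz (h : IsLogMap H T) :
    ∃ k : ℂ → ℂ, DifferentiableOn ℂ k (ball 0 1) ∧ k 0 = T ∧
      (∀ z, k (Complex.exp (-z)) = H z - z) ∧ ∀ w ∈ ball (0 : ℂ) 1, 0 ≤ (k w).re := by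
  obtain ⟨k, hd, hk0, hkz⟩ := exists_eq_comp_exp_neg (u := fun z => H z - z)
    (h.differentiableOn.sub differentiableOn_id)
    (fun z => by simp only [h.add_period, add_sub_add_right_eq_sub]) h.tendsto
  refine ⟨k, hd, hk0, hkz, fun w hw => re_nonneg_of_log_norm_le hd (fun v hv hv0 => ?_) hw⟩
  have hlog : 0 < (-Complex.log v).re := by
    rw [Complex.neg_re, Complex.log_re, neg_pos]
    exact Real.log_neg (norm_pos_iff.2 hv0) (by simpa using hv)
  have hkv := hkz (-Complex.log v)
  rw [neg_neg, Complex.exp_log hv0, sub_neg_eq_add] at hkv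
  rw [hkv, Complex.add_re, Complex.log_re]
  linarith [h.re_pos _ hlog]

lemma re_le (h : IsLogMap H T) (hz : 0 < z.re) : z.re ≤ (H z).re := by
  obtain ⟨k, -, -, hkz, hk⟩ := h.exists_herglotz
  simpa [hkz] using hk _ (exp_neg_mem_ball hz)

lemma norm_sub_le (h : IsLogMap H T) (hz : 0 < z.re) :
    ‖H z - z - T‖ ≤ 2 * T / (Real.exp z.re - 1) := by
  obtain ⟨k, hd, hk0, hkz, hk⟩ := h.exists_herglotz
  have hb := norm_sub_le_of_re_nonneg hd hk (exp_neg_mem_ball hz)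
  rwa [hkz, hk0, Complex.ofReal_re, Complex.norm_exp, Complex.neg_re, mul_div_assoc,
    exp_neg_div_one_sub_exp_neg, mul_one_div] at hb

end IsLogMap

lemma logSlitMap_add_period (c : ℝ) (z : ℂ) :
    logSlitMap c (z + 2 * Real.pi * Complex.I) = logSlitMap c z + 2 * Real.pi * Complex.I := by
  simp only [logSlitMap, Complex.exp_periodic z]
  ring

lemma logRotSlitMap_add_period (c θ : ℝ) (z : ℂ) :
    logRotSlitMap c θ (z + 2 * Real.pi * Complex.I) =
      logRotSlitMap c θ z + 2 * Real.pi * Complex.I := by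
  rw [logRotSlitMap, add_sub_right_comm, logSlitMap_add_period, ← add_assoc, logRotSlitMap]

lemma logClusterMap_add_period (c θ : ℕ → ℝ) (n : ℕ) (z : ℂ) :
    logClusterMap c θ n (z + 2 * Real.pi * Complex.I) =
      logClusterMap c θ n z + 2 * Real.pi * Complex.I := by
  induction n generalizing z with
  | zero => rfl
  | succ n ih => simp only [logClusterMap, Function.comp_apply, logRotSlitMap_add_period, ih]

lemma isLogMap_logSlitMap {c : ℝ} (hc : 0 ≤ c) : IsLogMap (logSlitMap c) c where
  differentiableOn _ hz := (differentiableAt_logSlitMap hc hz).differentiableWithinAt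
  add_period := logSlitMap_add_period c
  re_pos _ hz := logSlitMap_re_pos hc hz
  tendsto := tendsto_logSlitMap hc

lemma isLogMap_logClusterMap {c : ℕ → ℝ} (hc : ∀ k, 0 ≤ c k) (θ : ℕ → ℝ) (n : ℕ) :
    IsLogMap (logClusterMap c θ n) (totalCap c n) where
  differentiableOn := differentiableOn_logClusterMap hc θ n
  add_period := logClusterMap_add_period c θ n
  re_pos z hz := by
    induction n generalizing z with
    | zero => exact hz
    | succ n ih => exact ih _ (logRotSlitMap_re_pos (hc n) hz)
  tendsto := tendsto_logClusterMap hc θ n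

lemma logClusterMap_add (c θ : ℕ → ℝ) (m n : ℕ) (z : ℂ) :
    logClusterMap c θ (m + n) z =
      logClusterMap c θ m (logClusterMap (fun k => c (m + k)) (fun k => θ (m + k)) n z) := by
  induction n generalizing z with
  | zero => rfl
  | succ n ih => exact ih _

lemma totalCap_add (c : ℕ → ℝ) (m n : ℕ) :
    totalCap c (m + n) = totalCap c m + totalCap (fun k => c (m + k)) n :=
  Finset.sum_range_add c m n

end LogMap

section UniformAngle

/-- The law of the attachment angles, uniform on `[0, 2π)`; it is the measure against which
`pdf.IsUniform` compares. -/
noncomputable def uniformAngle : Measure ℝ :=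
  ProbabilityTheory.cond volume (Set.Ico 0 (2 * Real.pi))

instance : IsProbabilityMeasure uniformAngle :=
  cond_isProbabilityMeasure_of_finite (by simp [Real.pi_pos]) (by simp [ENNReal.mul_eq_top])

lemma circleAverage_eq_integral_uniformAngle (φ : ℂ → ℂ) (R : ℝ) :
    Real.circleAverage φ 0 R = ∫ t : ℝ, φ (R * Complex.exp (t * Complex.I)) ∂uniformAngle := by
  rw [Real.circleAverage_def, intervalIntegral.integral_of_le Real.two_pi_pos.le,
    uniformAngle, ProbabilityTheory.cond, integral_smul_measure, integral_Ico_eq_integral_Ioc]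
  congr 1
  · simp [Real.pi_pos.le]
  · simp [circleMap]

lemma integral_uniformAngle_mul_exp {φ : ℂ → ℂ} (hφ : DifferentiableOn ℂ φ (ball 0 1)) {w : ℂ}
    (hw : w ∈ ball (0 : ℂ) 1) :
    ∫ t : ℝ, φ (w * Complex.exp (t * Complex.I)) ∂uniformAngle = φ 0 := by
  have hd : DiffContOnCl ℂ (fun v => φ (w * v)) (ball 0 |1|) := by
    apply DifferentiableOn.diffContOnCl
    rw [abs_one, closure_ball _ one_ne_zero]
    refine hφ.comp (by fun_prop) fun v hv => ?_
    rw [mem_ball_zero_iff] at hw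
    rw [mem_closedBall_zero_iff] at hv
    rw [mem_ball_zero_iff, norm_mul]
    exact mul_lt_one_of_nonneg_of_lt_one_left (norm_nonneg w) hw hv
  simpa [circleAverage_eq_integral_uniformAngle] using hd.circleAverage

end UniformAngle

section ExponentialMoments

variable {α : Type*} [MeasurableSpace α] {ν : Measure α} [IsProbabilityMeasure ν]

-- `‖ξ‖² = 2 (Re ξ)² - Re ξ²`, and `(r - Re ξ) (Re ξ + a) ≥ 0` bounds `(Re ξ)²` by `a r` up to a
-- multiple of the centred variable `Re ξ`.
lemma integral_norm_sq_le {ξ : α → ℂ} (hm : AEStronglyMeasurable ξ ν) {a r : ℝ}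
    (hr : ∀ᵐ t ∂ν, ‖ξ t‖ ≤ r) (ha : ∀ᵐ t ∂ν, -a ≤ (ξ t).re) (h1 : ∫ t, ξ t ∂ν = 0)
    (h2 : ∫ t, ξ t ^ 2 ∂ν = 0) : ∫ t, ‖ξ t‖ ^ 2 ∂ν ≤ 2 * a * r := by
  have hint : Integrable ξ ν := .of_bound hm r hr
  have hint2 : Integrable (fun t => ξ t ^ 2) ν := by
    refine .of_bound (hm.pow 2) (r ^ 2) (hr.mono fun t ht => ?_)
    rw [norm_pow]
    gcongr
  have hre : ∫ t, (ξ t).re ∂ν = 0 := by simpa [h1] using integral_re hint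
  have hre2 : ∫ t, (ξ t ^ 2).re ∂ν = 0 := by simpa [h2] using integral_re hint2
  have hintre : Integrable (fun t => (ξ t).re) ν := hint.re
  have hintre2 : Integrable (fun t => (ξ t ^ 2).re) ν := hint2.re
  have hlin : Integrable (fun t => 2 * a * r + 2 * (r - a) * (ξ t).re) ν :=
    (integrable_const _).add (hintre.const_mul _)
  have hpt : ∀ᵐ t ∂ν, ‖ξ t‖ ^ 2 ≤ 2 * a * r + 2 * (r - a) * (ξ t).re - (ξ t ^ 2).re := by
    filter_upwards [hr, ha] with t hrt hat
    rw [← Complex.normSq_eq_norm_sq, Complex.normSq_apply, pow_two (ξ t), Complex.mul_re]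
    nlinarith [mul_nonneg (sub_nonneg.2 ((Complex.re_le_norm _).trans hrt)) (sub_nonneg.2 hat)]
  calc ∫ t, ‖ξ t‖ ^ 2 ∂ν
      ≤ ∫ t, (2 * a * r + 2 * (r - a) * (ξ t).re - (ξ t ^ 2).re) ∂ν :=
        integral_mono_ae (by simpa using hint2.norm) (hlin.sub hintre2) hpt
    _ = 2 * a * r + 2 * (r - a) * ∫ t, (ξ t).re ∂ν - ∫ t, (ξ t ^ 2).re ∂ν := by
        rw [integral_sub hlin hintre2, integral_add (integrable_const _) (hintre.const_mul _),
          integral_const_mul (2 * (r - a)), integral_const, probReal_univ, one_smul]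
    _ = 2 * a * r := by rw [hre, hre2]; ring

lemma integral_exp_le_exp_integral_sq {X : α → ℝ} (hm : AEStronglyMeasurable X ν)
    (hX : ∀ᵐ t ∂ν, |X t| ≤ 1) (h0 : ∫ t, X t ∂ν = 0) :
    Integrable (fun t => Real.exp (X t)) ν ∧
      ∫ t, Real.exp (X t) ∂ν ≤ Real.exp (∫ t, X t ^ 2 ∂ν) := by
  have hint : Integrable X ν := .of_bound hm 1 hX
  have hint2 : Integrable (fun t => X t ^ 2) ν :=
    .of_bound (hm.pow 2) 1 (hX.mono fun t ht => by
      rw [norm_pow]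
      exact pow_le_one₀ (norm_nonneg _) ht)
  have hexp : Integrable (fun t => Real.exp (X t)) ν :=
    .of_bound (Real.continuous_exp.comp_aestronglyMeasurable hm) (Real.exp 1)
      (hX.mono fun t ht => by
        rw [Real.norm_eq_abs, Real.abs_exp, Real.exp_le_exp]
        exact (le_abs_self _).trans ht)
  have hlin : Integrable (fun t => 1 + X t) ν := (integrable_const _).add hint
  refine ⟨hexp, ?_⟩
  calc ∫ t, Real.exp (X t) ∂ν
      ≤ ∫ t, (1 + X t + X t ^ 2) ∂ν := by
        refine integral_mono_ae hexp (hlin.add hint2) (hX.mono fun t ht => ?_)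
        dsimp only
        linarith [le_of_abs_le (Real.abs_exp_sub_one_sub_id_le ht)]
    _ = 1 + ∫ t, X t ^ 2 ∂ν := by
        rw [integral_add hlin hint2, integral_add (integrable_const _) hint, h0]
        simp
    _ ≤ Real.exp (∫ t, X t ^ 2 ∂ν) := by
        rw [add_comm]
        exact Real.add_one_le_exp _

lemma lintegral_exp_re_mul_le {ξ : α → ℂ} (hm : AEStronglyMeasurable ξ ν) {a r : ℝ}
    (hr : ∀ᵐ t ∂ν, ‖ξ t‖ ≤ r) (ha : ∀ᵐ t ∂ν, -a ≤ (ξ t).re) (h1 : ∫ t, ξ t ∂ν = 0)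
    (h2 : ∫ t, ξ t ^ 2 ∂ν = 0) {μ : ℂ} (hμ : ‖μ‖ * r ≤ 1) :
    ∫⁻ t, ENNReal.ofReal (Real.exp (μ * ξ t).re) ∂ν
      ≤ ENNReal.ofReal (Real.exp (2 * ‖μ‖ ^ 2 * a * r)) := by
  have hmμ : AEStronglyMeasurable (fun t => (μ * ξ t).re) ν :=
    Complex.continuous_re.comp_aestronglyMeasurable (hm.const_mul μ)
  have hint : Integrable (fun t => μ * ξ t) ν := (Integrable.of_bound hm r hr).const_mul μ
  have hcentred : ∫ t, (μ * ξ t).re ∂ν = 0 := by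
    simpa [integral_const_mul, h1] using integral_re hint
  have hle : ∀ᵐ t ∂ν, |(μ * ξ t).re| ≤ 1 := hr.mono fun t ht => by
    refine (Complex.abs_re_le_norm _).trans ?_
    rw [norm_mul]
    exact (mul_le_mul_of_nonneg_left ht (norm_nonneg _)).trans hμ
  have hint2 : Integrable (fun t => ‖ξ t‖ ^ 2) ν :=
    .of_bound (hm.norm.pow 2) (r ^ 2) (hr.mono fun t ht => by
      rw [norm_pow, norm_norm]
      gcongr)
  have hsq : ∫ t, (μ * ξ t).re ^ 2 ∂ν ≤ 2 * ‖μ‖ ^ 2 * a * r :=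
    calc ∫ t, (μ * ξ t).re ^ 2 ∂ν
        ≤ ∫ t, ‖μ‖ ^ 2 * ‖ξ t‖ ^ 2 ∂ν := by
          refine integral_mono_of_nonneg (.of_forall fun t => sq_nonneg _) (hint2.const_mul _)
            (.of_forall fun t => ?_)
          dsimp only
          rw [← mul_pow, ← norm_mul, ← sq_abs]
          gcongr
          exact Complex.abs_re_le_norm _
      _ = ‖μ‖ ^ 2 * ∫ t, ‖ξ t‖ ^ 2 ∂ν := integral_const_mul _ _
      _ ≤ ‖μ‖ ^ 2 * (2 * a * r) := by
          gcongr
          exact integral_norm_sq_le hm hr ha h1 h2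
      _ = 2 * ‖μ‖ ^ 2 * a * r := by ring
  obtain ⟨hexp, hmgf⟩ := integral_exp_le_exp_integral_sq hmμ hle hcentred
  rw [← ofReal_integral_eq_lintegral_ofReal hexp (.of_forall fun t => (Real.exp_pos _).le)]
  exact ENNReal.ofReal_le_ofReal (hmgf.trans (Real.exp_le_exp.2 hsq))

end ExponentialMoments

section VariancePotential

lemma one_sub_exp_neg_pos {x : ℝ} (hx : 0 < x) : 0 < 1 - Real.exp (-x) := by simpa using hx

lemma exp_sub_one_pos {x : ℝ} (hx : 0 < x) : 0 < Real.exp x - 1 := by simpa using hx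

lemma le_exp_sub_one (x : ℝ) : x ≤ Real.exp x - 1 := by linarith [Real.add_one_le_exp x]

/-- The potential `∫_x^{x+T} dy / (e^y - 1)`: the variance, in units of the capacity, which is
accumulated by a point that starts at distance `x` from the cluster and moves away from it at unit
speed during a time `T`. -/
noncomputable def variancePotential (T x : ℝ) : ℝ :=
  Real.log (1 - Real.exp (-(x + T))) - Real.log (1 - Real.exp (-x))

lemma one_sub_exp_neg_le_mul {x ρ : ℝ} (hx : 0 < x) :
    1 - Real.exp (-(x + ρ)) ≤ (1 - Real.exp (-x)) * (1 + ρ / (Real.exp x - 1)) := by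
  have hE := (exp_sub_one_pos hx).ne'
  have hρ : Real.exp (-x) * (1 - ρ) ≤ Real.exp (-x) * Real.exp (-ρ) := by
    gcongr
    linarith [Real.add_one_le_exp (-ρ)]
  have hx1 : (1 - Real.exp (-x)) / (Real.exp x - 1) = Real.exp (-x) := by
    rw [div_eq_iff hE, mul_sub, ← Real.exp_add, neg_add_cancel, Real.exp_zero, mul_one]
  rw [neg_add, Real.exp_add, mul_add, mul_one, mul_div_assoc', mul_comm _ ρ, mul_div_assoc, hx1]
  linarith

-- The tangent bound for the concave function `log (1 - e^{-y})`.
lemma variancePotential_le_div_exp_sub_one {T x : ℝ} (hx : 0 < x) (hxT : 0 < x + T) :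
    variancePotential T x ≤ T / (Real.exp x - 1) := by
  have h1 := one_sub_exp_neg_pos hx
  have h2 := one_sub_exp_neg_pos hxT
  rw [variancePotential, ← Real.log_div h2.ne' h1.ne']
  refine (Real.log_le_sub_one_of_pos (div_pos h2 h1)).trans ?_
  rw [sub_le_iff_le_add', div_le_iff₀' h1]
  exact one_sub_exp_neg_le_mul hx

lemma variancePotential_add (S T x : ℝ) :
    variancePotential (S + T) x = variancePotential S x + variancePotential T (x + S) := by
  simp only [variancePotential, add_assoc]
  ring

lemma variancePotential_neg (T x : ℝ) :
    variancePotential (-T) (x + T) = -variancePotential T x := by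
  simp [variancePotential]

lemma variancePotential_le_log {T x : ℝ} (hx : 0 < x) (hT : 0 ≤ T) :
    variancePotential T x ≤ Real.log ((x + T) / x) := by
  have h1 := one_sub_exp_neg_pos hx
  have h2 := one_sub_exp_neg_pos (show 0 < x + T by linarith)
  rw [variancePotential, ← Real.log_div h2.ne' h1.ne']
  refine Real.log_le_log (div_pos h2 h1) ?_
  calc (1 - Real.exp (-(x + T))) / (1 - Real.exp (-x))
      ≤ 1 + T / (Real.exp x - 1) := by
        rw [div_le_iff₀' h1]
        exact one_sub_exp_neg_le_mul hx
    _ ≤ 1 + T / x := by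
        gcongr
        exact le_exp_sub_one x
    _ = (x + T) / x := by field_simp

lemma variancePotential_nonneg {T x : ℝ} (hx : 0 < x) (hT : 0 ≤ T) :
    0 ≤ variancePotential T x := by
  have hpos := one_sub_exp_neg_pos hx
  rw [variancePotential, sub_nonneg]
  gcongr
  linarith

lemma variancePotential_mono {S T x : ℝ} (hx : 0 < x) (hS : 0 ≤ S) (hST : S ≤ T) :
    variancePotential S x ≤ variancePotential T x := by
  have hpos := one_sub_exp_neg_pos (show 0 < x + S by linarith)
  unfold variancePotential
  gcongr

/-- The factor by which `e^x - 1` can grow in the course of one jump. -/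
noncomputable def jumpConst : ℝ := 11 * Real.exp 10

lemma one_le_jumpConst : 1 ≤ jumpConst := by
  unfold jumpConst
  linarith [Real.add_one_le_exp 10]

lemma jumpConst_pos : 0 < jumpConst := one_pos.trans_le one_le_jumpConst

lemma exp_add_sub_one_le {x u : ℝ} (hx : 0 < x) (hu : u ≤ 10 * min x 1) :
    Real.exp (x + u) - 1 ≤ jumpConst * (Real.exp x - 1) := by
  have hE := exp_sub_one_pos hx
  have hexp : Real.exp u ≤ Real.exp 10 := by
    gcongr
    linarith [min_le_right x 1]
  have hsub : Real.exp u - 1 ≤ 10 * Real.exp 10 * (Real.exp x - 1) :=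
    calc Real.exp u - 1 = (1 - Real.exp (-u)) * Real.exp u := by
          rw [sub_mul, ← Real.exp_add, neg_add_cancel, Real.exp_zero, one_mul]
      _ ≤ (10 * x) * Real.exp 10 := by
          gcongr
          linarith [Real.add_one_le_exp (-u), min_le_left x 1]
      _ ≤ 10 * (Real.exp x - 1) * Real.exp 10 := by
          gcongr
          exact le_exp_sub_one x
      _ = 10 * Real.exp 10 * (Real.exp x - 1) := by ring
  calc Real.exp (x + u) - 1 = Real.exp u * (Real.exp x - 1) + (Real.exp u - 1) := by
        rw [Real.exp_add]
        ring
    _ ≤ Real.exp 10 * (Real.exp x - 1) + 10 * Real.exp 10 * (Real.exp x - 1) := by gcongr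
    _ = jumpConst * (Real.exp x - 1) := by
        unfold jumpConst
        ring

-- The remaining time drops by `a` while the point moves by `a + ρ`, so the potential decreases by
-- its slope times `a`, up to terms linear in `ρ`.
lemma variancePotential_jump_le {T a x ρ : ℝ} (hT : 0 ≤ T) (ha : 0 ≤ a) (hx : 0 < x)
    (hρ : 0 ≤ a + ρ) (hjump : a + ρ ≤ 10 * min x 1) :
    variancePotential T (x + (a + ρ)) ≤ variancePotential (T + a) x
      + ρ / (Real.exp (x + (T + a)) - 1) - (a + ρ) / (jumpConst * (Real.exp x - 1)) := by
  have hsplit : variancePotential T (x + (a + ρ)) =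
      variancePotential (T + a) x + variancePotential ρ (x + (T + a))
        - variancePotential (a + ρ) x := by
    have h1 := variancePotential_add (a + ρ) T x
    have h2 := variancePotential_add (T + a) ρ x
    rw [show T + a + ρ = a + ρ + T by ring] at h2
    linarith
  have hend := variancePotential_le_div_exp_sub_one (T := ρ) (x := x + (T + a)) (by linarith)
    (by linarith)
  have hstart := variancePotential_le_div_exp_sub_one (T := -(a + ρ)) (x := x + (a + ρ))
    (by linarith) (by linarith)
  rw [variancePotential_neg, neg_div, neg_le_neg_iff] at hstart
  have hgrow : (a + ρ) / (jumpConst * (Real.exp x - 1)) ≤ (a + ρ) / (Real.exp (x + (a + ρ)) - 1) :=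
    div_le_div_of_nonneg_left hρ (exp_sub_one_pos (by linarith)) (exp_add_sub_one_le hx hjump)
  linarith

end VariancePotential

section SlitFluct

/-- The displacement of `z` under a slit map of capacity `a` rotated by the angle `t`, in
logarithmic coordinates and minus its mean `a`. -/
noncomputable def slitFluct (a : ℝ) (z : ℂ) (t : ℝ) : ℂ := logRotSlitMap a t z - z - a

lemma measurable_slitMap (c : ℝ) : Measurable (slitMap c) := by
  unfold slitMap halfPlaneSlit cayley
  fun_prop

lemma measurable_logSlitMap (c : ℝ) : Measurable (logSlitMap c) := by
  have := measurable_slitMap c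
  unfold logSlitMap
  fun_prop

lemma measurable_logRotSlitMap (c : ℝ) :
    Measurable (fun p : ℝ × ℂ => logRotSlitMap c p.1 p.2) := by
  have := measurable_logSlitMap c
  unfold logRotSlitMap
  fun_prop

lemma measurable_slitFluct (a : ℝ) (z : ℂ) : Measurable (slitFluct a z) :=
  (((measurable_logRotSlitMap a).comp measurable_prodMk_right).sub_const _).sub_const _

lemma logRotSlitMap_re (a t : ℝ) (z : ℂ) :
    (logRotSlitMap a t z).re = z.re + (a + (slitFluct a z t).re) := by
  simp [slitFluct]

lemma slitFluct_eq (a : ℝ) (z : ℂ) (t : ℝ) :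
    slitFluct a z t = logSlitMap a (z - t * Complex.I) - (z - t * Complex.I) - a := by
  rw [slitFluct, logRotSlitMap]
  ring

variable {a : ℝ} (ha : 0 ≤ a) {z : ℂ} (hz : 0 < z.re)
include ha

lemma exists_slitFluct_eq : ∃ k : ℂ → ℂ, DifferentiableOn ℂ k (ball 0 1) ∧
    k 0 = 0 ∧ ∀ z t, slitFluct a z t = k (Complex.exp (-z) * Complex.exp (t * Complex.I)) := by
  obtain ⟨k, hd, hk0, hkz, -⟩ := (isLogMap_logSlitMap ha).exists_herglotz
  refine ⟨fun w => k w - a, hd.sub_const _, by simp [hk0], fun z t => ?_⟩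
  rw [slitFluct_eq, ← hkz, neg_sub, sub_eq_neg_add (_ * _), Complex.exp_add]

include hz

lemma integral_slitFluct : ∫ t, slitFluct a z t ∂uniformAngle = 0 := by
  obtain ⟨k, hd, hk0, hk⟩ := exists_slitFluct_eq ha
  simp_rw [hk]
  rw [integral_uniformAngle_mul_exp hd (exp_neg_mem_ball hz), hk0]

lemma integral_slitFluct_sq : ∫ t, slitFluct a z t ^ 2 ∂uniformAngle = 0 := by
  obtain ⟨k, hd, hk0, hk⟩ := exists_slitFluct_eq ha
  simp_rw [hk]
  rw [integral_uniformAngle_mul_exp (φ := fun w => k w ^ 2) (hd.pow 2) (exp_neg_mem_ball hz), hk0,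
    zero_pow two_ne_zero]

lemma norm_slitFluct_le (t : ℝ) : ‖slitFluct a z t‖ ≤ 2 * a / (Real.exp z.re - 1) := by
  rw [slitFluct_eq]
  simpa using (isLogMap_logSlitMap ha).norm_sub_le (z := z - t * Complex.I) (by simpa using hz)

lemma neg_le_slitFluct_re (t : ℝ) : -a ≤ (slitFluct a z t).re := by
  have h := (isLogMap_logSlitMap ha).re_le (z := z - t * Complex.I) (by simpa using hz)
  rw [slitFluct_eq, Complex.sub_re, Complex.sub_re, Complex.ofReal_re]
  linarith

end SlitFluct

section TiltedJump

/-- The standing smallness assumptions for the exponential martingale of points at distance at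
least `s` from the cluster, with exponential parameter of size at most `ℓ` and particles of capacity
at most `c`. -/
structure AdmissibleTilt (c s ℓ : ℝ) : Prop where
  cap_le_one : c ≤ 1
  pos : 0 < s
  cap_le_cube : c ≤ (2 * s) ^ 3
  tilt_nonneg : 0 ≤ ℓ
  tilt_mul_cap_le : 16 * jumpConst * (ℓ * c) ≤ s

/-- The coefficient of `variancePotential` in the exponential martingale, chosen such that the
decrease of the potential over one jump pays for the second moment of that jump. -/
noncomputable def tiltRate (c ℓ : ℝ) : ℝ := 16 * jumpConst * (ℓ ^ 2 * c)

lemma tiltRate_nonneg {c : ℝ} (hc : 0 ≤ c) (ℓ : ℝ) : 0 ≤ tiltRate c ℓ := by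
  have := jumpConst_pos
  unfold tiltRate
  positivity

namespace AdmissibleTilt

variable {c s ℓ x : ℝ}

lemma cap_le (h : AdmissibleTilt c s ℓ) (hx : s ≤ x) : c ≤ 2 * x ∧ c ≤ 4 * x ^ 2 := by
  have hs := h.pos
  have hcube : c ≤ (2 * x) ^ 3 := h.cap_le_cube.trans (by gcongr)
  rcases le_total (2 * x) 1 with hx1 | hx1
  · have hpow1 := pow_le_of_le_one (by linarith) hx1 three_ne_zero
    have hpow2 : (2 * x) ^ 3 ≤ (2 * x) ^ 2 := pow_le_pow_of_le_one (by linarith) hx1 (by norm_num)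
    constructor <;> linarith
  · have hpow := one_le_pow₀ hx1 (n := 2)
    constructor <;> linarith [h.cap_le_one]

lemma jump_le (h : AdmissibleTilt c s ℓ) {a : ℝ} (ha : 0 ≤ a) (hac : a ≤ c) {z : ℂ}
    (hz : s ≤ z.re) (t : ℝ) : a + (slitFluct a z t).re ≤ 10 * min z.re 1 := by
  have hx : 0 < z.re := h.pos.trans_le hz
  obtain ⟨hcx, hcx2⟩ := h.cap_le hz
  have hre : (slitFluct a z t).re ≤ 2 * c / z.re :=
    (Complex.re_le_norm _).trans ((norm_slitFluct_le ha hx t).trans (by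
      have hc := ha.trans hac
      gcongr
      exact le_exp_sub_one _))
  rcases le_total z.re 1 with hx1 | hx1
  · rw [min_eq_left hx1]
    have : 2 * c / z.re ≤ 8 * z.re := by
      rw [div_le_iff₀ hx]
      linarith
    linarith
  · rw [min_eq_right hx1]
    have : 2 * c / z.re ≤ 2 * 1 / 1 :=
      div_le_div₀ (by norm_num) (by linarith [h.cap_le_one]) one_pos hx1
    linarith [h.cap_le_one]

lemma tiltRate_div_le (h : AdmissibleTilt c s ℓ) (hx : s ≤ x) :
    tiltRate c ℓ / (Real.exp x - 1) ≤ ℓ := by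
  have hs := h.pos
  rw [div_le_iff₀ (exp_sub_one_pos (by linarith))]
  calc tiltRate c ℓ = ℓ * (16 * jumpConst * (ℓ * c)) := by
        unfold tiltRate
        ring
    _ ≤ ℓ * (Real.exp x - 1) := by
        gcongr
        · exact h.tilt_nonneg
        · exact h.tilt_mul_cap_le.trans (hx.trans (le_exp_sub_one x))

lemma exists_tilt (h : AdmissibleTilt c s ℓ) {a T : ℝ} (ha : 0 ≤ a) (hac : a ≤ c) (hT : 0 ≤ T)
    {lam : ℂ} (hlam : ‖lam‖ ≤ ℓ) {z : ℂ} (hz : s ≤ z.re) :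
    ∃ μ : ℂ, ‖μ‖ ≤ 2 * ℓ ∧ ∀ t, (lam * slitFluct a z t).re
        + tiltRate c ℓ * variancePotential T (logRotSlitMap a t z).re ≤
      tiltRate c ℓ * variancePotential (T + a) z.re
        - tiltRate c ℓ * a / (jumpConst * (Real.exp z.re - 1)) + (μ * slitFluct a z t).re := by
  have hx : 0 < z.re := h.pos.trans_le hz
  have hE := exp_sub_one_pos hx
  have hκ := tiltRate_nonneg (ha.trans hac) ℓ
  set p := 1 / (Real.exp (z.re + (T + a)) - 1) with hp
  set q := 1 / (jumpConst * (Real.exp z.re - 1)) with hq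
  have hp0 : 0 ≤ p := (one_div_pos.2 (exp_sub_one_pos (by linarith))).le
  have hq0 : 0 ≤ q := (one_div_pos.2 (mul_pos jumpConst_pos hE)).le
  have hpE : p ≤ 1 / (Real.exp z.re - 1) := by
    rw [hp]
    gcongr
    linarith
  have hqE : q ≤ 1 / (Real.exp z.re - 1) :=
    one_div_le_one_div_of_le hE (le_mul_of_one_le_left hE.le one_le_jumpConst)
  have hdrift : ‖((tiltRate c ℓ * (p - q) : ℝ) : ℂ)‖ ≤ ℓ := by
    rw [Complex.norm_real, Real.norm_eq_abs, abs_mul, abs_of_nonneg hκ]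
    calc tiltRate c ℓ * |p - q| ≤ tiltRate c ℓ * (1 / (Real.exp z.re - 1)) := by
          gcongr
          exact abs_sub_le_of_nonneg_of_le hp0 hpE hq0 hqE
      _ ≤ ℓ := by
          rw [mul_one_div]
          exact h.tiltRate_div_le hz
  refine ⟨lam + (tiltRate c ℓ * (p - q) : ℝ), (norm_add_le _ _).trans (by linarith), fun t => ?_⟩
  have hV := variancePotential_jump_le hT ha hx (by linarith [neg_le_slitFluct_re ha hx t])
    (h.jump_le ha hac hz t)
  rw [← logRotSlitMap_re, div_eq_mul_one_div _ (Real.exp _ - 1), ← hp,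
    div_eq_mul_one_div _ (jumpConst * _), ← hq] at hV
  rw [add_mul, Complex.add_re, Complex.re_ofReal_mul, div_eq_mul_one_div, ← hq]
  linarith [mul_le_mul_of_nonneg_left hV hκ]

lemma mul_jump_le_one (h : AdmissibleTilt c s ℓ) {a m : ℝ} (ha : 0 ≤ a) (hac : a ≤ c)
    (hm : m ≤ 2 * ℓ) (hx : s ≤ x) : m * (2 * a / (Real.exp x - 1)) ≤ 1 := by
  have hℓ := h.tilt_nonneg
  have hc := ha.trans hac
  rw [mul_div_assoc', div_le_one₀ (exp_sub_one_pos (h.pos.trans_le hx))]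
  calc m * (2 * a) ≤ (2 * ℓ) * (2 * c) := by gcongr
    _ ≤ 16 * jumpConst * (ℓ * c) := by
        nlinarith [mul_nonneg hℓ hc,
          mul_le_mul_of_nonneg_right one_le_jumpConst (mul_nonneg hℓ hc)]
    _ ≤ Real.exp x - 1 := h.tilt_mul_cap_le.trans (hx.trans (le_exp_sub_one x))

lemma lintegral_exp_slitFluct_le (h : AdmissibleTilt c s ℓ) {a T : ℝ} (ha : 0 ≤ a) (hac : a ≤ c)
    (hT : 0 ≤ T) {lam : ℂ} (hlam : ‖lam‖ ≤ ℓ) {z : ℂ} (hz : s ≤ z.re) :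
    ∫⁻ t, ENNReal.ofReal (Real.exp ((lam * slitFluct a z t).re
        + tiltRate c ℓ * variancePotential T (logRotSlitMap a t z).re)) ∂uniformAngle
      ≤ ENNReal.ofReal (Real.exp (tiltRate c ℓ * variancePotential (T + a) z.re)) := by
  have hx : 0 < z.re := h.pos.trans_le hz
  have hE := exp_sub_one_pos hx
  have := h.tilt_nonneg
  have := ha.trans hac
  have hJ := jumpConst_pos
  obtain ⟨μ, hμ, hpt⟩ := h.exists_tilt ha hac hT hlam hz
  have hmgf := lintegral_exp_re_mul_le (ν := uniformAngle)
    (measurable_slitFluct a z).aestronglyMeasurable (.of_forall (norm_slitFluct_le ha hx))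
    (.of_forall (neg_le_slitFluct_re ha hx)) (integral_slitFluct ha hx)
    (integral_slitFluct_sq ha hx) (h.mul_jump_le_one ha hac hμ hz)
  set K := tiltRate c ℓ * variancePotential (T + a) z.re
    - tiltRate c ℓ * a / (jumpConst * (Real.exp z.re - 1))
  have hpay : 2 * ‖μ‖ ^ 2 * a * (2 * a / (Real.exp z.re - 1)) ≤
      tiltRate c ℓ * a / (jumpConst * (Real.exp z.re - 1)) :=
    calc 2 * ‖μ‖ ^ 2 * a * (2 * a / (Real.exp z.re - 1))
        ≤ 2 * (2 * ℓ) ^ 2 * a * (2 * c / (Real.exp z.re - 1)) := by gcongr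
      _ = tiltRate c ℓ * a / (jumpConst * (Real.exp z.re - 1)) := by
          unfold tiltRate
          field_simp
          ring
  calc _ ≤ ∫⁻ t, ENNReal.ofReal (Real.exp K)
          * ENNReal.ofReal (Real.exp (μ * slitFluct a z t).re) ∂uniformAngle := by
        refine lintegral_mono fun t => ?_
        rw [← ENNReal.ofReal_mul (Real.exp_pos _).le, ← Real.exp_add]
        exact ENNReal.ofReal_le_ofReal (Real.exp_le_exp.2 (hpt t))
    _ ≤ ENNReal.ofReal (Real.exp K)
          * ENNReal.ofReal (Real.exp (2 * ‖μ‖ ^ 2 * a * (2 * a / (Real.exp z.re - 1)))) := by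
        rw [lintegral_const_mul' _ _ ENNReal.ofReal_ne_top]
        gcongr
    _ ≤ _ := by
        rw [← ENNReal.ofReal_mul (Real.exp_pos _).le, ← Real.exp_add]
        exact ENNReal.ofReal_le_ofReal (Real.exp_le_exp.2 (by linarith))

end AdmissibleTilt

end TiltedJump

section Conditioning

variable {Ω : Type*} [MeasurableSpace Ω] {P : Measure Ω} [IsProbabilityMeasure P]

lemma lintegral_prodMk_of_indepFun {α β : Type*} [MeasurableSpace α] [MeasurableSpace β]
    {X : Ω → α} {Y : Ω → β} (hX : Measurable X) (hY : Measurable Y) (hXY : IndepFun X Y P)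
    {F : α → β → ENNReal} (hF : Measurable (Function.uncurry F)) :
    ∫⁻ ω, F (X ω) (Y ω) ∂P = ∫⁻ y, ∫⁻ ω, F (X ω) y ∂P ∂P.map Y := by
  have : IsProbabilityMeasure (P.map X) := Measure.isProbabilityMeasure_map hX.aemeasurable
  have : IsProbabilityMeasure (P.map Y) := Measure.isProbabilityMeasure_map hY.aemeasurable
  calc ∫⁻ ω, F (X ω) (Y ω) ∂P
      = ∫⁻ p, Function.uncurry F p ∂P.map (fun ω => (X ω, Y ω)) :=
        (lintegral_map hF (hX.prodMk hY)).symm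
    _ = ∫⁻ y, ∫⁻ x, F x y ∂P.map X ∂P.map Y := by
        rw [hXY.map_prod_eq_prod_map_map hX.aemeasurable hY.aemeasurable,
          lintegral_prod_symm' _ hF]
        rfl
    _ = ∫⁻ y, ∫⁻ ω, F (X ω) y ∂P ∂P.map Y :=
        lintegral_congr fun y => lintegral_map (hF.comp measurable_prodMk_right) hX

lemma lintegral_of_dependsOn {ι : Type*} {α : ι → Type*} [∀ i, MeasurableSpace (α i)]
    {X : ∀ i, Ω → α i} (hm : ∀ i, Measurable (X i)) (hX : iIndepFun X P) {S : Finset ι} {i : ι}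
    (hi : i ∉ S) {F : (∀ i, α i) → α i → ENNReal} (hF : Measurable (Function.uncurry F))
    (hFS : DependsOn F S) :
    ∫⁻ ω, F (fun k => X k ω) (X i ω) ∂P = ∫⁻ y, ∫⁻ ω, F (fun k => X k ω) y ∂P ∂P.map (X i) := by
  classical
  obtain ⟨ω₀⟩ := nonempty_of_isProbabilityMeasure P
  have hext : Measurable (Function.updateFinset (fun k => X k ω₀) S) := measurable_updateFinset
  set Y : Ω → ∀ i, α i :=
    fun ω => Function.updateFinset (fun k => X k ω₀) S (fun k => X k ω) with hY
  have hYm : Measurable Y := hext.comp (measurable_pi_lambda _ fun k => hm k)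
  have hFY : ∀ ω, F (fun k => X k ω) = F (Y ω) := fun ω => hFS fun k hk => by
    simp [hY, Function.updateFinset, Finset.mem_coe.1 hk]
  have hind : IndepFun Y (X i) P :=
    (hX.indepFun_finset S {i} (by simpa using hi) hm).comp hext
      (measurable_pi_apply (⟨i, by simp⟩ : ({i} : Finset ι)))
  simp_rw [hFY]
  exact lintegral_prodMk_of_indepFun hYm (hm i) hind hF

end Conditioning

section Fluctuation

/-- The fluctuation `Φ̃_n(z) - z - C_n` of the cluster map in logarithmic coordinates. -/
noncomputable def clusterFluct (c θ : ℕ → ℝ) (n : ℕ) (z : ℂ) : ℂ :=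
  logClusterMap c θ n z - z - totalCap c n

lemma dependsOn_logClusterMap (c : ℕ → ℝ) (n : ℕ) :
    DependsOn (fun θ => logClusterMap c θ n) (Finset.range n) := by
  induction n with
  | zero => exact fun _ _ _ => rfl
  | succ n ih =>
    intro θ θ' h
    have hpast := ih fun i hi =>
      h i (Finset.coe_subset.2 (Finset.range_subset_range.2 n.le_succ) hi)
    have hnow : θ n = θ' n := h n (by simp)
    simp only [logClusterMap, hnow] at hpast ⊢
    rw [hpast]

lemma clusterFluct_succ (c θ : ℕ → ℝ) (n : ℕ) (z : ℂ) :
    clusterFluct c θ (n + 1) z =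
      slitFluct (c n) z (θ n) + clusterFluct c θ n (logRotSlitMap (c n) (θ n) z) := by
  simp only [clusterFluct, slitFluct, logClusterMap, Function.comp_apply, totalCap,
    Finset.sum_range_succ]
  push_cast
  ring

lemma clusterFluct_add (c θ : ℕ → ℝ) (m n : ℕ) (z : ℂ) :
    clusterFluct c θ (m + n) z =
      clusterFluct c θ m (logClusterMap (fun k => c (m + k)) (fun k => θ (m + k)) n z)
        + clusterFluct (fun k => c (m + k)) (fun k => θ (m + k)) n z := by
  simp only [clusterFluct, logClusterMap_add, totalCap_add]
  push_cast
  ring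

lemma measurable_clusterFluct (c : ℕ → ℝ) (n : ℕ) :
    Measurable (fun p : (ℕ → ℝ) × ℂ => clusterFluct c p.1 n p.2) := by
  refine Measurable.sub_const (Measurable.sub ?_ measurable_snd) _
  induction n with
  | zero => exact measurable_snd
  | succ n ih =>
    have hrot : Measurable fun p : (ℕ → ℝ) × ℂ => logRotSlitMap (c n) (p.1 n) p.2 :=
      (measurable_logRotSlitMap (c n)).comp
        (f := fun p : (ℕ → ℝ) × ℂ => (p.1 n, p.2)) (by fun_prop)
    exact ih.comp (measurable_fst.prodMk hrot)

variable {c : ℕ → ℝ} (hc : ∀ k, 0 ≤ c k)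

include hc

lemma totalCap_nonneg (n : ℕ) : 0 ≤ totalCap c n := Finset.sum_nonneg fun k _ => hc k

lemma totalCap_mono : Monotone (totalCap c) :=
  monotone_nat_of_le_succ fun n => by simpa [totalCap, Finset.sum_range_succ] using hc n

lemma norm_clusterFluct_le (θ : ℕ → ℝ) (n : ℕ) {σ : ℝ} (hσ : 0 < σ) {z : ℂ} (hz : σ < z.re) :
    ‖clusterFluct c θ n z‖ ≤ 2 * totalCap c n / (Real.exp σ - 1) := by
  refine ((isLogMap_logClusterMap hc θ n).norm_sub_le (hσ.trans hz)).trans ?_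
  have := exp_sub_one_pos hσ
  have := totalCap_nonneg hc n
  gcongr

end Fluctuation

section ExponentialMoment

variable {Ω : Type*} [MeasurableSpace Ω]

/-- The angles at which the slits are attached: independent and uniform on `[0, 2π)`. -/
structure IsUniformAngles (θ : ℕ → Ω → ℝ) (P : Measure Ω) : Prop where
  measurable : ∀ k, Measurable (θ k)
  indep : iIndepFun θ P
  uniform : ∀ k, pdf.IsUniform (θ k) (Set.Ico 0 (2 * Real.pi)) P

variable {P : Measure Ω} [IsProbabilityMeasure P] {θ : ℕ → Ω → ℝ} {c : ℕ → ℝ} {cmax s ℓ : ℝ}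

lemma lintegral_exp_clusterFluct_succ (hθ : IsUniformAngles θ P) (c : ℕ → ℝ) (lam : ℂ) (n : ℕ)
    (z : ℂ) :
    ∫⁻ ω, ENNReal.ofReal (Real.exp (lam * clusterFluct c (fun k => θ k ω) (n + 1) z).re) ∂P =
      ∫⁻ t, ENNReal.ofReal (Real.exp (lam * slitFluct (c n) z t).re) *
        ∫⁻ ω, ENNReal.ofReal (Real.exp (lam * clusterFluct c (fun k => θ k ω) n
          (logRotSlitMap (c n) t z)).re) ∂P ∂uniformAngle := by
  set F : (ℕ → ℝ) → ℝ → ENNReal := fun v t =>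
    ENNReal.ofReal (Real.exp (lam * slitFluct (c n) z t).re) * ENNReal.ofReal
      (Real.exp (lam * clusterFluct c v n (logRotSlitMap (c n) t z)).re) with hFdef
  have hF : Measurable (Function.uncurry F) := by
    have hrot : Measurable fun p : (ℕ → ℝ) × ℝ => logRotSlitMap (c n) p.2 z :=
      (measurable_logRotSlitMap (c n)).comp (measurable_snd.prodMk measurable_const)
    have hpast := (measurable_clusterFluct c n).comp (measurable_fst.prodMk hrot)
    have hslit : Measurable fun p : (ℕ → ℝ) × ℝ => slitFluct (c n) z p.2 :=
      (measurable_slitFluct (c n) z).comp measurable_snd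
    exact (hslit.const_mul lam).re.exp.ennreal_ofReal.mul
      (hpast.const_mul lam).re.exp.ennreal_ofReal
  have hFn : DependsOn F (Finset.range n) := fun v v' hv => by
    simp only [hFdef, clusterFluct, dependsOn_logClusterMap c n hv]
  have hsplit (ω : Ω) :
      ENNReal.ofReal (Real.exp (lam * clusterFluct c (fun k => θ k ω) (n + 1) z).re) =
        F (fun k => θ k ω) (θ n ω) := by
    simp only [hFdef, clusterFluct_succ, mul_add, Complex.add_re, Real.exp_add,
      ENNReal.ofReal_mul (Real.exp_pos _).le]
  simp_rw [hsplit, lintegral_of_dependsOn hθ.measurable hθ.indep Finset.notMem_range_self hF hFn,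
    show P.map (θ n) = uniformAngle from hθ.uniform n, hFdef,
    lintegral_const_mul' _ _ ENNReal.ofReal_ne_top]

lemma lintegral_exp_clusterFluct_le (hθ : IsUniformAngles θ P) (hc : ∀ k, 0 ≤ c k)
    (hcm : ∀ k, c k ≤ cmax) (h : AdmissibleTilt cmax s ℓ) {lam : ℂ} (hlam : ‖lam‖ ≤ ℓ) (n : ℕ)
    {z : ℂ} (hz : s ≤ z.re) :
    ∫⁻ ω, ENNReal.ofReal (Real.exp (lam * clusterFluct c (fun k => θ k ω) n z).re) ∂P
      ≤ ENNReal.ofReal (Real.exp (tiltRate cmax ℓ * variancePotential (totalCap c n) z.re)) := by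
  induction n generalizing z with
  | zero => simp [clusterFluct, logClusterMap, totalCap, variancePotential]
  | succ n ih =>
    have hre (t : ℝ) : s ≤ (logRotSlitMap (c n) t z).re := by
      rw [logRotSlitMap_re]
      linarith [neg_le_slitFluct_re (hc n) (h.pos.trans_le hz) t]
    rw [lintegral_exp_clusterFluct_succ hθ,
      show totalCap c (n + 1) = totalCap c n + c n from Finset.sum_range_succ _ _]
    refine (lintegral_mono fun t => ?_).trans
      (h.lintegral_exp_slitFluct_le (hc n) (hcm n) (totalCap_nonneg hc n) hlam hz)
    rw [Real.exp_add, ENNReal.ofReal_mul (Real.exp_pos _).le]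
    gcongr
    exact ih (hre t)

end ExponentialMoment

section HalfPlaneMaximum

lemma enorm_le_lintegral_circle {F : ℂ → ℂ} {r : ℝ} (hF : DiffContOnCl ℂ F (ball 0 r)) {w : ℂ}
    (hw : ‖w‖ < r) :
    ‖F w‖ₑ ≤ ENNReal.ofReal (r / (r - ‖w‖)) *
      ∫⁻ t : ℝ, ‖F (r * Complex.exp (t * Complex.I))‖ₑ ∂uniformAngle := by
  have hr : 0 < r := (norm_nonneg w).trans_lt hw
  rw [← abs_of_pos hr] at hF
  have hcauchy := hF.circleAverage_smul_div (w := w) (by rwa [mem_ball_zero_iff, abs_of_pos hr])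
  rw [circleAverage_eq_integral_uniformAngle] at hcauchy
  rw [← hcauchy, ← lintegral_const_mul' _ _ ENNReal.ofReal_ne_top]
  refine (enorm_integral_le_lintegral_enorm _).trans (lintegral_mono fun t => ?_)
  have hv : ‖(r : ℂ) * Complex.exp (t * Complex.I)‖ = r := by
    rw [norm_mul, Complex.norm_exp_ofReal_mul_I, Complex.norm_real, Real.norm_eq_abs,
      abs_of_pos hr, mul_one]
  have hvw := norm_sub_norm_le ((r : ℂ) * Complex.exp (t * Complex.I)) w
  rw [hv] at hvw
  rw [smul_eq_mul, enorm_mul, sub_zero, ← ofReal_norm, norm_div, hv]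
  have := sub_pos.2 hw
  gcongr

lemma IsLogMap.exp_re_le_lintegral {H : ℂ → ℂ} {T : ℝ} (h : IsLogMap H T) (lam : ℂ) {s : ℝ}
    (hs : 0 < s) {z : ℂ} (hz : 2 * s ≤ z.re) :
    ENNReal.ofReal (Real.exp (lam * (H z - z - T)).re) ≤ ENNReal.ofReal (1 / (1 - Real.exp (-s))) *
      ∫⁻ t : ℝ, ENNReal.ofReal
        (Real.exp (lam * (H (s - t * Complex.I) - (s - t * Complex.I) - T)).re)
        ∂uniformAngle := by
  obtain ⟨k, hd, -, hkz, -⟩ := h.exists_herglotz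
  set r := Real.exp (-s) with hr
  have hr0 : 0 < r := Real.exp_pos _
  have hr1 : r < 1 := by simpa [hr] using hs
  have hw : ‖Complex.exp (-z)‖ ≤ r * r := by
    rw [Complex.norm_exp, hr, ← Real.exp_add, Real.exp_le_exp, Complex.neg_re]
    linarith
  have hw_lt : ‖Complex.exp (-z)‖ < r := by nlinarith
  have hF : DiffContOnCl ℂ (fun w => Complex.exp (lam * (k w - T))) (ball 0 r) := by
    refine ((hd.sub_const _).const_mul _).cexp.diffContOnCl_ball ?_
    exact closedBall_subset_ball hr1
  have hcirc (t : ℝ) : (r : ℂ) * Complex.exp (t * Complex.I) =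
      Complex.exp (-(s - t * Complex.I)) := by
    rw [hr, Complex.ofReal_exp, ← Complex.exp_add]
    congr 1
    push_cast
    ring
  have hmean := enorm_le_lintegral_circle hF hw_lt
  simp_rw [hcirc, hkz, ← ofReal_norm, Complex.norm_exp (lam * _)] at hmean
  refine hmean.trans ?_
  gcongr ENNReal.ofReal ?_ * _
  rw [div_le_div_iff₀ (sub_pos.2 hw_lt) (sub_pos.2 hr1)]
  linarith

lemma exists_re_I_pow_mul_ge (w : ℂ) :
    ∃ j ∈ Finset.range 4, 2 / 3 * ‖w‖ ≤ (Complex.I ^ j * w).re := by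
  obtain ⟨j, hj, hmax⟩ : ∃ j ∈ Finset.range 4, max |w.re| |w.im| = (Complex.I ^ j * w).re := by
    rcases max_choice |w.re| |w.im| with h | h
    · rcases abs_choice w.re with h' | h'
      · exact ⟨0, by simp, by rw [h, h']; simp⟩
      · exact ⟨2, by simp, by rw [h, h']; simp [pow_succ]⟩
    · rcases abs_choice w.im with h' | h'
      · exact ⟨3, by simp, by rw [h, h']; simp [pow_succ]⟩
      · exact ⟨1, by simp, by rw [h, h']; simp [pow_succ]⟩
  refine ⟨j, hj, ?_⟩
  have hsqrt : √2 ≤ 3 / 2 := Real.sqrt_le_iff.2 (by norm_num)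
  have hmax0 : 0 ≤ max |w.re| |w.im| := (abs_nonneg _).trans (le_max_left _ _)
  rw [← hmax]
  nlinarith [Complex.norm_le_sqrt_two_mul_max w]

lemma measurable_exp_clusterFluct_circle {Ω : Type*} [MeasurableSpace Ω] {θ : ℕ → Ω → ℝ}
    (hθ : ∀ k, Measurable (θ k)) (c : ℕ → ℝ) (lam : ℂ) (s : ℝ) (n : ℕ) :
    Measurable fun p : Ω × ℝ => ENNReal.ofReal (Real.exp
      (lam * clusterFluct c (fun k => θ k p.1) n (s - p.2 * Complex.I)).re) := by
  have hpath : Measurable fun p : Ω × ℝ =>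
      ((fun k => θ k p.1, s - p.2 * Complex.I) : (ℕ → ℝ) × ℂ) :=
    (measurable_pi_lambda _ fun k => (hθ k).comp measurable_fst).prodMk (by fun_prop)
  have hfluct := (measurable_clusterFluct c n).comp hpath
  exact (hfluct.const_mul lam).re.exp.ennreal_ofReal

variable {Ω : Type*} [MeasurableSpace Ω] {P : Measure Ω} [IsProbabilityMeasure P]
  {θ : ℕ → Ω → ℝ} (hθ : IsUniformAngles θ P) {c : ℕ → ℝ} {cmax s ℓ : ℝ} (hc : ∀ k, 0 ≤ c k)
  (hcm : ∀ k, c k ≤ cmax) (h : AdmissibleTilt cmax s ℓ)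

include hθ hc hcm h

lemma lintegral_lintegral_exp_clusterFluct_le {lam : ℂ} (hlam : ‖lam‖ ≤ ℓ) (n : ℕ) :
    ∫⁻ ω, ∫⁻ t : ℝ, ENNReal.ofReal (Real.exp (lam * clusterFluct c (fun k => θ k ω) n
        (s - t * Complex.I)).re) ∂uniformAngle ∂P ≤
      ENNReal.ofReal (Real.exp (tiltRate cmax ℓ * variancePotential (totalCap c n) s)) := by
  set g : Ω → ℝ → ENNReal := fun ω t => ENNReal.ofReal (Real.exp
    (lam * clusterFluct c (fun k => θ k ω) n (s - t * Complex.I)).re)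
  have hg : Measurable (Function.uncurry g) :=
    measurable_exp_clusterFluct_circle hθ.measurable c lam s n
  have hpt (t : ℝ) : ∫⁻ ω, g ω t ∂P ≤
      ENNReal.ofReal (Real.exp (tiltRate cmax ℓ * variancePotential (totalCap c n) s)) := by
    have hre : ((s : ℂ) - t * Complex.I).re = s := by simp
    simpa only [hre] using lintegral_exp_clusterFluct_le hθ hc hcm h hlam n hre.ge
  calc ∫⁻ ω, ∫⁻ t, g ω t ∂uniformAngle ∂P = ∫⁻ t, ∫⁻ ω, g ω t ∂P ∂uniformAngle :=
        lintegral_lintegral_swap hg.aemeasurable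
    _ ≤ ∫⁻ _, ENNReal.ofReal (Real.exp (tiltRate cmax ℓ * variancePotential (totalCap c n) s))
          ∂uniformAngle := lintegral_mono hpt
    _ = _ := by rw [lintegral_const, measure_univ, mul_one]

lemma measure_exists_le_re_clusterFluct_le {lam : ℂ} (hlam : ‖lam‖ ≤ ℓ) (x : ℝ) (n : ℕ) :
    P {ω | ∃ z : ℂ, 2 * s < z.re ∧ x ≤ (lam * clusterFluct c (fun k => θ k ω) n z).re} ≤
      ENNReal.ofReal (1 / (1 - Real.exp (-s)) *
        Real.exp (tiltRate cmax ℓ * variancePotential (totalCap c n) s - x)) := by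
  set D := ENNReal.ofReal (1 / (1 - Real.exp (-s)))
  set A : Ω → ENNReal := fun ω => ∫⁻ t : ℝ, ENNReal.ofReal (Real.exp
    (lam * clusterFluct c (fun k => θ k ω) n (s - t * Complex.I)).re) ∂uniformAngle
  have hA : Measurable A :=
    (measurable_exp_clusterFluct_circle hθ.measurable c lam s n).lintegral_prod_right'
  have hsub : {ω | ∃ z : ℂ, 2 * s < z.re ∧ x ≤ (lam * clusterFluct c (fun k => θ k ω) n z).re} ⊆
      {ω | ENNReal.ofReal (Real.exp x) ≤ D * A ω} := fun ω ⟨z, hz, hx⟩ =>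
    (ENNReal.ofReal_le_ofReal (Real.exp_le_exp.2 hx)).trans
      ((isLogMap_logClusterMap hc (fun k => θ k ω) n).exp_re_le_lintegral lam h.pos hz.le)
  calc _ ≤ P {ω | ENNReal.ofReal (Real.exp x) ≤ D * A ω} := measure_mono hsub
    _ ≤ (∫⁻ ω, D * A ω ∂P) / ENNReal.ofReal (Real.exp x) :=
        meas_ge_le_lintegral_div (hA.const_mul D).aemeasurable (by simpa using Real.exp_pos x)
          ENNReal.ofReal_ne_top
    _ ≤ D * ENNReal.ofReal (Real.exp (tiltRate cmax ℓ * variancePotential (totalCap c n) s)) /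
          ENNReal.ofReal (Real.exp x) := by
        rw [lintegral_const_mul' _ _ ENNReal.ofReal_ne_top]
        gcongr
        exact lintegral_lintegral_exp_clusterFluct_le hθ hc hcm h hlam n
    _ = _ := by
        have := one_sub_exp_neg_pos h.pos
        rw [Real.exp_sub, ← mul_div_assoc, ENNReal.ofReal_div_of_pos (Real.exp_pos x),
          ENNReal.ofReal_mul (by positivity)]

lemma measure_exists_le_norm_clusterFluct_le (ε : ℝ) (n : ℕ) :
    P {ω | ∃ z : ℂ, 2 * s < z.re ∧ ε / 2 ≤ ‖clusterFluct c (fun k => θ k ω) n z‖} ≤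
      ENNReal.ofReal (4 / (1 - Real.exp (-s)) *
        Real.exp (tiltRate cmax ℓ * variancePotential (totalCap c n) s - ℓ * ε / 3)) := by
  set dir : ℕ → ℂ := fun j => ℓ * Complex.I ^ j with hdir
  have hnorm (j : ℕ) : ‖dir j‖ ≤ ℓ := by simp [hdir, abs_of_nonneg h.tilt_nonneg]
  have hsub : {ω | ∃ z : ℂ, 2 * s < z.re ∧ ε / 2 ≤ ‖clusterFluct c (fun k => θ k ω) n z‖} ⊆
      ⋃ j ∈ Finset.range 4, {ω | ∃ z : ℂ, 2 * s < z.re ∧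
        ℓ * ε / 3 ≤ (dir j * clusterFluct c (fun k => θ k ω) n z).re} := by
    rintro ω ⟨z, hz, hzε⟩
    obtain ⟨j, hj, hre⟩ := exists_re_I_pow_mul_ge (clusterFluct c (fun k => θ k ω) n z)
    refine Set.mem_biUnion hj ⟨z, hz, ?_⟩
    rw [hdir, mul_assoc, Complex.re_ofReal_mul]
    nlinarith [h.tilt_nonneg]
  calc _ ≤ ∑ j ∈ Finset.range 4, P {ω | ∃ z : ℂ, 2 * s < z.re ∧
            ℓ * ε / 3 ≤ (dir j * clusterFluct c (fun k => θ k ω) n z).re} :=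
        (measure_mono hsub).trans (measure_biUnion_finset_le _ _)
    _ ≤ ∑ j ∈ Finset.range 4, ENNReal.ofReal (1 / (1 - Real.exp (-s)) *
          Real.exp (tiltRate cmax ℓ * variancePotential (totalCap c n) s - ℓ * ε / 3)) :=
        Finset.sum_le_sum fun j _ =>
          measure_exists_le_re_clusterFluct_le hθ hc hcm h (hnorm j) _ n
    _ = _ := by
        rw [Finset.sum_const, Finset.card_range, ← ENNReal.ofReal_nsmul, nsmul_eq_mul]
        congr 1
        push_cast
        ring

end HalfPlaneMaximum

section TimeDiscretisation

/-- The first time at which the total capacity reaches the level `x`; it is `0` (the infimum of the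
empty set) if the level is never reached. -/
noncomputable def hitTime (c : ℕ → ℝ) (x : ℝ) : ℕ := sInf {n | x ≤ totalCap c n}

/-- The maximal fluctuation `sup ‖Φ̃_n(z) - z - C_n‖` over the times `n ≤ N` and the half-plane
`Re z > σ`, as an extended nonnegative real. -/
noncomputable def maxFluct (c θ : ℕ → ℝ) (N : ℕ) (σ : ℝ) : ENNReal :=
  ⨆ n ≤ N, ⨆ z ∈ {z : ℂ | σ < z.re}, ‖clusterFluct c θ n z‖ₑ

lemma hitTime_le {c : ℕ → ℝ} {x : ℝ} {n : ℕ} (h : x ≤ totalCap c n) : hitTime c x ≤ n :=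
  Nat.sInf_le h

lemma le_totalCap_hitTime {c : ℕ → ℝ} {x : ℝ} {n : ℕ} (h : x ≤ totalCap c n) :
    x ≤ totalCap c (hitTime c x) := Nat.sInf_mem (s := {n | x ≤ totalCap c n}) ⟨n, h⟩

variable {c : ℕ → ℝ} (hc : ∀ k, 0 ≤ c k) {σ : ℝ} (hσ : 0 < σ)

include hc hσ

lemma norm_clusterFluct_le_add (θ : ℕ → ℝ) {m n : ℕ} (hmn : m ≤ n) {η : ℝ}
    (hη : ∀ z : ℂ, σ < z.re → ‖clusterFluct c θ m z‖ ≤ η) {z : ℂ} (hz : σ < z.re) :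
    ‖clusterFluct c θ n z‖ ≤ η + 2 * (totalCap c n - totalCap c m) / (Real.exp σ - 1) := by
  obtain ⟨k, rfl⟩ := Nat.exists_eq_add_of_le hmn
  have hc' : ∀ i, 0 ≤ c (m + i) := fun i => hc _
  rw [clusterFluct_add, totalCap_add, add_sub_cancel_left]
  refine (norm_add_le _ _).trans (add_le_add (hη _ ?_) (norm_clusterFluct_le hc' _ k hσ hz))
  exact hz.trans_le ((isLogMap_logClusterMap hc' _ k).re_le (hσ.trans hz))

lemma norm_clusterFluct_le_of_hitTime (θ : ℕ → ℝ) {w η : ℝ} (hw : 0 < w) {N : ℕ}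
    (h : ∀ q ∈ Finset.range (⌊totalCap c N / w⌋₊ + 1), ∀ z : ℂ, σ < z.re →
      ‖clusterFluct c θ (hitTime c (q * w)) z‖ ≤ η)
    {n : ℕ} (hn : n ≤ N) {z : ℂ} (hz : σ < z.re) :
    ‖clusterFluct c θ n z‖ ≤ η + 2 * w / (Real.exp σ - 1) := by
  set q := ⌊totalCap c n / w⌋₊
  have hqn : q * w ≤ totalCap c n :=
    (le_div_iff₀ hw).1 (Nat.floor_le (div_nonneg (totalCap_nonneg hc n) hw.le))
  have hnq : totalCap c n ≤ (q + 1) * w := (div_le_iff₀ hw).1 (Nat.lt_floor_add_one _).le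
  have hqN : q ∈ Finset.range (⌊totalCap c N / w⌋₊ + 1) :=
    Finset.mem_range_succ_iff.2
      (Nat.floor_le_floor (div_le_div_of_nonneg_right (totalCap_mono hc hn) hw.le))
  refine (norm_clusterFluct_le_add hc hσ θ (hitTime_le hqn) (h q hqN) hz).trans ?_
  have := exp_sub_one_pos hσ
  gcongr
  linarith [le_totalCap_hitTime hqn]

lemma exists_hitTime_of_le_maxFluct {θ : ℕ → ℝ} {w η ε : ℝ} (hw : 0 < w) (hε : 0 < ε)
    (hwε : η + 2 * w / (Real.exp σ - 1) < ε) {N : ℕ} (h : ENNReal.ofReal ε ≤ maxFluct c θ N σ) :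
    ∃ q ∈ Finset.range (⌊totalCap c N / w⌋₊ + 1), ∃ z : ℂ, σ < z.re ∧
      η ≤ ‖clusterFluct c θ (hitTime c (q * w)) z‖ := by
  by_contra! hsmall
  refine h.not_gt (lt_of_le_of_lt ?_ ((ENNReal.ofReal_lt_ofReal_iff hε).2 hwε))
  refine iSup₂_le fun n hn => iSup₂_le fun z hz => ?_
  rw [← ofReal_norm]
  exact ENNReal.ofReal_le_ofReal <| norm_clusterFluct_le_of_hitTime hc hσ θ hw
    (fun q hq z hz => (hsmall q hq z hz).le) hn hz

omit hσ in
lemma totalCap_hitTime_le {N q : ℕ} {w : ℝ} (hw : 0 < w)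
    (hq : q ∈ Finset.range (⌊totalCap c N / w⌋₊ + 1)) :
    totalCap c (hitTime c (q * w)) ≤ totalCap c N := by
  refine totalCap_mono hc (hitTime_le ((le_div_iff₀ hw).1 ?_))
  exact (Nat.cast_le.2 (Finset.mem_range_succ_iff.1 hq)).trans
    (Nat.floor_le (div_nonneg (totalCap_nonneg hc N) hw.le))

end TimeDiscretisation

section MaximalFluctuation

variable {Ω : Type*} [MeasurableSpace Ω] {P : Measure Ω} [IsProbabilityMeasure P]

lemma one_sub_measureReal_compl_le (E : Set Ω) : 1 - P.real Eᶜ ≤ P.real E := by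
  have h := measureReal_union_le (μ := P) E Eᶜ
  rw [Set.union_compl_self, probReal_univ] at h
  linarith

lemma measureReal_le_maxFluct_le {θ : ℕ → Ω → ℝ} (hθ : IsUniformAngles θ P) {c : ℕ → ℝ}
    {cmax σ ℓ ε : ℝ} (hc : ∀ k, 0 ≤ c k) (hcm : ∀ k, c k ≤ cmax)
    (h : AdmissibleTilt cmax (σ / 2) ℓ) (hε : 0 < ε) (N : ℕ) :
    P.real {ω | ENNReal.ofReal ε ≤ maxFluct c (fun k => θ k ω) N σ} ≤
      (8 * totalCap c N / (ε * (Real.exp σ - 1)) + 1) * (4 / (1 - Real.exp (-(σ / 2))) *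
        Real.exp (tiltRate cmax ℓ * variancePotential (totalCap c N) (σ / 2) - ℓ * ε / 3)) := by
  have hσ : 0 < σ := by linarith [h.pos]
  have hE := exp_sub_one_pos hσ
  have hE' := one_sub_exp_neg_pos h.pos
  have hT := totalCap_nonneg hc N
  set w := ε * (Real.exp σ - 1) / 8 with hw
  have hw0 : 0 < w := by positivity
  set Q := Finset.range (⌊totalCap c N / w⌋₊ + 1)
  set bad : ℕ → Set Ω := fun q => {ω | ∃ z : ℂ, 2 * (σ / 2) < z.re ∧
    ε / 2 ≤ ‖clusterFluct c (fun k => θ k ω) (hitTime c (q * w)) z‖} with hbad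
  set M := 4 / (1 - Real.exp (-(σ / 2))) *
    Real.exp (tiltRate cmax ℓ * variancePotential (totalCap c N) (σ / 2) - ℓ * ε / 3) with hM
  have hsub : {ω | ENNReal.ofReal ε ≤ maxFluct c (fun k => θ k ω) N σ} ⊆ ⋃ q ∈ Q, bad q := by
    intro ω hω
    have hwε : ε / 2 + 2 * w / (Real.exp σ - 1) < ε := by
      have : 2 * w / (Real.exp σ - 1) = ε / 4 := by rw [hw]; field_simp; norm_num
      linarith
    obtain ⟨q, hq, hz⟩ := exists_hitTime_of_le_maxFluct hc hσ hw0 hε hwε hω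
    exact Set.mem_biUnion hq (by rwa [hbad, Set.mem_ofPred_eq, mul_div_cancel₀ σ two_ne_zero])
  have hbad_le : ∀ q ∈ Q, P.real (bad q) ≤ M := by
    intro q hq
    refine ENNReal.toReal_le_of_le_ofReal (by positivity)
      ((measure_exists_le_norm_clusterFluct_le hθ hc hcm h ε _).trans (ENNReal.ofReal_le_ofReal ?_))
    have := tiltRate_nonneg ((hc 0).trans (hcm 0)) ℓ
    rw [hM]
    gcongr
    exact variancePotential_mono h.pos (totalCap_nonneg hc _) (totalCap_hitTime_le hc hw0 hq)
  calc _ ≤ P.real (⋃ q ∈ Q, bad q) := measureReal_mono hsub (measure_ne_top _ _)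
    _ ≤ ∑ q ∈ Q, P.real (bad q) := measureReal_biUnion_finset_le _ _
    _ ≤ Q.card * M := by simpa using Finset.sum_le_card_nsmul Q _ M hbad_le
    _ ≤ (totalCap c N / w + 1) * M := by
        rw [Finset.card_range]
        push_cast
        gcongr
        exact Nat.floor_le (by positivity)
    _ = _ := by rw [hw, div_div_eq_mul_div, mul_comm _ (8 : ℝ)]

end MaximalFluctuation

section FailureBound

/-- The reciprocal of the exponential rate of the failure probability, up to a constant. -/
noncomputable def rateDenom (σ ε : ℝ) (N : ℕ) : ℝ := Real.log ((σ + N * ε) / σ) + ε / σ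

/-- The exponential rate left over after optimising the tilt in `measureReal_le_maxFluct_le`. -/
noncomputable def rateConst : ℝ := 1 / (36 * (16 * jumpConst))

/-- The bound, with prefactor `A` and rate `a`, for the probability that the fluctuation up to time
`N` on the half-plane `Re z > σ` reaches `ε`. -/
noncomputable def failureBound (A a c ε σ : ℝ) (N : ℕ) : ℝ :=
  A * N * (c ^ (8 / 5 : ℝ) / (ε ^ (11 / 5 : ℝ) * min (σ ^ (9 / 5 : ℝ)) 1)) *
    Real.exp (-(a / rateDenom σ ε N * (ε ^ 2 / c)))

lemma rateConst_pos : 0 < rateConst := by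
  have := jumpConst_pos
  unfold rateConst
  positivity

lemma rateConst_le_half : rateConst ≤ 1 / 2 := by
  have := one_le_jumpConst
  unfold rateConst
  gcongr
  linarith

lemma rpow_le_one_add {y p : ℝ} (hy : 0 ≤ y) (hp₀ : 0 ≤ p) (hp₁ : p ≤ 1) : y ^ p ≤ 1 + y :=
  calc y ^ p ≤ (1 + y) ^ p := by gcongr; linarith
    _ ≤ 1 + p * y := rpow_one_add_le_one_add_mul_self (by linarith) hp₀ hp₁
    _ ≤ 1 + y := by gcongr; exact mul_le_of_le_one_left hy hp₁

lemma rpow_mul_exp_neg_le {y p b : ℝ} (hy : 0 ≤ y) (hp₀ : 0 ≤ p) (hp₁ : p ≤ 1) (hb : 0 < b) :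
    y ^ p * Real.exp (-(b * y)) ≤ 1 + 1 / b := by
  rw [Real.exp_neg, ← div_eq_mul_inv, div_le_iff₀ (Real.exp_pos _)]
  calc y ^ p ≤ 1 + y := rpow_le_one_add hy hp₀ hp₁
    _ ≤ 1 + y + (b * y + 1 / b) := le_add_of_nonneg_right (by positivity)
    _ = (1 + 1 / b) * (b * y + 1) := by field_simp; ring
    _ ≤ (1 + 1 / b) * Real.exp (b * y) := by gcongr; exact Real.add_one_le_exp _

lemma mul_exp_half_le {x : ℝ} (hx : 0 ≤ x) : x * Real.exp (x / 2) ≤ Real.exp x - 1 := by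
  have hsinh : x ≤ Real.exp (x / 2) - Real.exp (-(x / 2)) := by
    have := Real.self_le_sinh_iff.2 (show 0 ≤ x / 2 by positivity)
    rw [Real.sinh_eq] at this
    linarith
  calc x * Real.exp (x / 2)
      ≤ (Real.exp (x / 2) - Real.exp (-(x / 2))) * Real.exp (x / 2) := by gcongr
    _ = Real.exp x - 1 := by
        rw [sub_mul, ← Real.exp_add, ← Real.exp_add, add_halves, neg_add_cancel, Real.exp_zero]

variable {A a c ε σ : ℝ} {N : ℕ}

lemma min_rpow_one (hσ : 0 ≤ σ) {p : ℝ} (hp : 0 ≤ p) : min (σ ^ p) 1 = min σ 1 ^ p := by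
  rcases le_total σ 1 with h | h
  · rw [min_eq_left h, min_eq_left (Real.rpow_le_one hσ h hp)]
  · rw [min_eq_right h, min_eq_right (Real.one_le_rpow h hp), Real.one_rpow]

lemma div_le_rateDenom (hσ : 0 < σ) (hε : 0 < ε) : ε / σ ≤ rateDenom σ ε N := by
  refine le_add_of_nonneg_left (Real.log_nonneg ((one_le_div hσ).2 ?_))
  exact le_add_of_nonneg_right (by positivity)

lemma rateDenom_pos (hσ : 0 < σ) (hε : 0 < ε) : 0 < rateDenom σ ε N :=
  (div_pos hε hσ).trans_le (div_le_rateDenom hσ hε)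

lemma failureBound_eq (hc : 0 < c) (hε : 0 < ε) (hσ : 0 < σ) :
    failureBound A a c ε σ N = A * (N * c / ε) *
      ((c / ε ^ 2) ^ (3 / 5 : ℝ) / min σ 1 ^ (9 / 5 : ℝ)) *
        Real.exp (-(a * (ε ^ 2 / (c * rateDenom σ ε N)))) := by
  have hcp : c ^ (8 / 5 : ℝ) = c * c ^ (3 / 5 : ℝ) := by
    rw [← Real.rpow_one_add' hc.le (by norm_num)]
    norm_num
  have hεp : ε ^ (11 / 5 : ℝ) = ε * (ε ^ 2) ^ (3 / 5 : ℝ) := by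
    rw [← Real.rpow_natCast, ← Real.rpow_mul hε.le, ← Real.rpow_one_add' hε.le (by norm_num)]
    norm_num
  have hexp : a / rateDenom σ ε N * (ε ^ 2 / c) =
      a * (ε ^ 2 / (c * rateDenom σ ε N)) := by ring
  rw [failureBound, hexp, min_rpow_one hσ.le (by norm_num), hcp, hεp,
    Real.div_rpow hc.le (by positivity)]
  ring

lemma failureBound_nonneg (hA : 0 ≤ A) (hc : 0 < c) (hε : 0 < ε) (hσ : 0 < σ) :
    0 ≤ failureBound A a c ε σ N := by
  have : 0 < min σ 1 := lt_min hσ one_pos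
  rw [failureBound_eq hc hε hσ]
  positivity

lemma failureBound_le {σ' : ℝ} (hA : 0 ≤ A) (ha : 0 ≤ a) (hc : 0 < c) (hσ' : 0 < σ')
    (hε : 0 < ε) (hσσ' : σ' ≤ σ) (hεσ : ε < σ) :
    failureBound A a c ε σ N ≤ A * N *
      (c ^ (8 / 5 : ℝ) / (ε ^ (11 / 5 : ℝ) * min (σ' ^ (9 / 5 : ℝ)) 1)) *
        Real.exp (-(a /
          (Real.log (1 / σ') + Real.log (σ + N * ε) + ε / (σ - ε)) * (ε ^ 2 / c))) := by
  have hσ : 0 < σ := hσ'.trans_le hσσ'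
  have hL := rateDenom_pos (N := N) hσ hε
  have hrate : rateDenom σ ε N ≤
      Real.log (1 / σ') + Real.log (σ + N * ε) + ε / (σ - ε) := by
    have hlog : Real.log σ' ≤ Real.log σ := Real.log_le_log hσ' hσσ'
    have hdiv : ε / σ ≤ ε / (σ - ε) :=
      div_le_div_of_nonneg_left hε.le (sub_pos.2 hεσ) (by linarith)
    rw [rateDenom, Real.log_div (by positivity) hσ.ne', one_div, Real.log_inv]
    linarith
  have : 0 < min (σ' ^ (9 / 5 : ℝ)) 1 := lt_min (by positivity) one_pos
  unfold failureBound
  gcongr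

section LargeCapacity

lemma div_four_le_rateDenom (hε : 0 < ε) (hσ : 0 < σ) (hcε : c ≤ ε ^ 2)
    (hX : (Real.exp σ - 1) / 4 ≤ N * c / ε) : σ / 4 ≤ rateDenom σ ε N := by
  have hgrowth : σ * Real.exp (σ / 4) ^ 2 / 4 ≤ N * ε := calc
    σ * Real.exp (σ / 4) ^ 2 / 4 = σ * Real.exp (σ / 2) / 4 := by
        rw [← Real.exp_nat_mul]; ring_nf
    _ ≤ (Real.exp σ - 1) / 4 := by gcongr; exact mul_exp_half_le hσ.le
    _ ≤ N * c / ε := hX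
    _ ≤ N * ε ^ 2 / ε := by gcongr
    _ = N * ε := by field_simp
  refine le_add_of_le_of_nonneg ((Real.le_log_iff_exp_le (by positivity)).2 ?_) (by positivity)
  rw [le_div_iff₀ hσ]
  nlinarith [mul_nonneg hσ.le (sq_nonneg (Real.exp (σ / 4) / 2 - 1))]

lemma sq_div_le_of_large_cap (hc : 0 < c) (hε : 0 < ε) (hσ : 0 < σ) (hεσ : ε ≤ σ)
    (h : ε < c ∨ 1 < c) (hX : (Real.exp σ - 1) / 4 ≤ N * c / ε) :
    ε ^ 2 / (c * rateDenom σ ε N) ≤ 4 * σ := by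
  have hL := rateDenom_pos (N := N) hσ hε
  rw [div_le_iff₀ (by positivity)]
  rcases lt_or_ge ε c with hεc | hcε
  · have hεL : ε ≤ rateDenom σ ε N * σ := (div_le_iff₀ hσ).1 (div_le_rateDenom hσ hε)
    nlinarith
  · have hc₁ : 1 < c := h.resolve_left hcε.not_gt
    have hσL := div_four_le_rateDenom hε hσ (by nlinarith) hX
    have hLc : rateDenom σ ε N ≤ c * rateDenom σ ε N := le_mul_of_one_le_left hL.le hc₁.le
    nlinarith

lemma cube_div_le_of_large_cap (hε : 0 < ε) (hσ : 0 < σ) (hεσ : ε ≤ σ)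
    (hcσ : c ≤ σ ^ 3) (h : ε < c ∨ 1 < c) : (min σ 1 / σ) ^ 3 ≤ c / ε ^ 2 := by
  rcases le_or_gt c 1 with hc₁ | hc₁
  · have hεc : ε < c := h.resolve_right hc₁.not_gt
    calc (min σ 1 / σ) ^ 3 ≤ 1 :=
          pow_le_one₀ (by positivity) ((div_le_one hσ).2 (min_le_left _ _))
      _ ≤ c / ε ^ 2 := (one_le_div (by positivity)).2 (by nlinarith)
  · have hσ₁ : 1 < σ := (one_lt_pow_iff_of_nonneg hσ.le three_ne_zero).1 (hc₁.trans_le hcσ)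
    have hεσc : ε ^ 2 ≤ c * σ ^ 3 := calc
      ε ^ 2 ≤ σ ^ 2 := by gcongr
      _ ≤ σ ^ 3 := pow_le_pow_right₀ hσ₁.le (by norm_num)
      _ ≤ c * σ ^ 3 := le_mul_of_one_le_left (by positivity) hc₁.le
    rw [min_eq_right hσ₁.le, div_pow, one_pow, div_le_div_iff₀ (by positivity) (by positivity)]
    linarith

lemma one_le_failureBound (hA : 16 ≤ A) (ha : a ≤ 1 / 16) (hc : 0 < c) (hε : 0 < ε) (hσ : 0 < σ)
    (hεσ : ε ≤ σ) (hcσ : c ≤ σ ^ 3) (h : ε < c ∨ 1 < c)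
    (hX : (Real.exp σ - 1) / 4 ≤ N * c / ε) : 1 ≤ failureBound A a c ε σ N := by
  have hv : 0 < min σ 1 := lt_min hσ one_pos
  have hprefactor : 1 / σ ^ (9 / 5 : ℝ) ≤
      (c / ε ^ 2) ^ (3 / 5 : ℝ) / min σ 1 ^ (9 / 5 : ℝ) := by
    rw [div_le_div_iff₀ (by positivity) (by positivity), one_mul, ← div_le_iff₀ (by positivity)]
    calc min σ 1 ^ (9 / 5 : ℝ) / σ ^ (9 / 5 : ℝ) = ((min σ 1 / σ) ^ 3) ^ (3 / 5 : ℝ) := by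
          rw [← Real.div_rpow hv.le hσ.le, ← Real.rpow_natCast, ← Real.rpow_mul (by positivity)]
          norm_num
      _ ≤ (c / ε ^ 2) ^ (3 / 5 : ℝ) := by
          gcongr
          exact cube_div_le_of_large_cap hε hσ hεσ hcσ h
  have hX' : σ * Real.exp (σ / 2) / 4 ≤ N * c / ε :=
    (div_le_div_of_nonneg_right (mul_exp_half_le hσ.le) (by norm_num)).trans hX
  have hexp : Real.exp (-(σ / 4)) ≤
      Real.exp (-(a * (ε ^ 2 / (c * rateDenom σ ε N)))) := by
    have hK := sq_div_le_of_large_cap hc hε hσ hεσ h hX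
    have := mul_le_mul ha hK
      (by have := rateDenom_pos (N := N) hσ hε; positivity) (by norm_num)
    exact Real.exp_le_exp.2 (by linarith)
  have hpow : σ ^ (9 / 5 : ℝ) ≤ σ * (1 + σ) := calc
    σ ^ (9 / 5 : ℝ) = σ * σ ^ (4 / 5 : ℝ) := by
        rw [← Real.rpow_one_add' hσ.le (by norm_num)]; norm_num
    _ ≤ σ * (1 + σ) := by gcongr; exact rpow_le_one_add hσ.le (by norm_num) (by norm_num)
  rw [failureBound_eq hc hε hσ]
  calc (1 : ℝ) ≤ 4 * (σ * (σ / 4 + 1)) / σ ^ (9 / 5 : ℝ) := by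
        rw [one_le_div (by positivity)]; nlinarith
    _ ≤ 4 * (σ * Real.exp (σ / 4)) / σ ^ (9 / 5 : ℝ) := by
        gcongr; exact Real.add_one_le_exp _
    _ = 16 * (σ * Real.exp (σ / 2) / 4) * (1 / σ ^ (9 / 5 : ℝ)) * Real.exp (-(σ / 4)) := by
        rw [show σ / 2 = σ / 4 + σ / 4 by ring, Real.exp_add, Real.exp_neg]
        field_simp
        norm_num
    _ ≤ _ := by gcongr

end LargeCapacity

section SmallCapacity

/-- The accumulated variance up to capacity `T`, together with the contribution of the constraint
that the tilt be admissible. -/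
noncomputable def tiltDenom (T σ ε : ℝ) : ℝ := variancePotential T (σ / 2) + ε / (σ / 2)

variable {T : ℝ}

lemma div_half_le_tiltDenom (hσ : 0 < σ) (hT : 0 ≤ T) : ε / (σ / 2) ≤ tiltDenom T σ ε :=
  le_add_of_nonneg_left (variancePotential_nonneg (half_pos hσ) hT)

lemma tiltDenom_pos (hε : 0 < ε) (hσ : 0 < σ) (hT : 0 ≤ T) : 0 < tiltDenom T σ ε :=
  (div_pos hε (half_pos hσ)).trans_le (div_half_le_tiltDenom hσ hT)

lemma min_div_four_le_one_sub_exp (hσ : 0 < σ) : min σ 1 / 4 ≤ 1 - Real.exp (-(σ / 2)) := by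
  have hv : 0 < min σ 1 := lt_min hσ one_pos
  have hmono : Real.exp (-(σ / 2)) ≤ Real.exp (-(min σ 1 / 2)) :=
    Real.exp_le_exp.2 (by linarith [min_le_left σ 1])
  have hinv : Real.exp (-(min σ 1 / 2)) ≤ (min σ 1 / 2 + 1)⁻¹ := by
    rw [Real.exp_neg]
    gcongr
    exact Real.add_one_le_exp _
  have : (min σ 1 / 2 + 1)⁻¹ ≤ 1 - min σ 1 / 4 := by
    rw [inv_le_iff_one_le_mul₀ (by positivity)]
    nlinarith [min_le_right σ 1]
  linarith

lemma tiltDenom_le (hσ : 0 < σ) (hT : 0 ≤ T) (hεσ : ε ≤ σ) :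
    tiltDenom T σ ε ≤ 4 / √(min σ 1) := by
  have hv : 0 < min σ 1 := lt_min hσ one_pos
  have hpotential : variancePotential T (σ / 2) ≤ -Real.log (1 - Real.exp (-(σ / 2))) := by
    have := one_sub_exp_neg_pos (show 0 < σ / 2 + T by positivity)
    have : Real.log (1 - Real.exp (-(σ / 2 + T))) ≤ 0 :=
      Real.log_nonpos this.le (by linarith [Real.exp_pos (-(σ / 2 + T))])
    rw [variancePotential]
    linarith
  have hlog : -Real.log (1 - Real.exp (-(σ / 2))) ≤ 2 * Real.log (2 / √(min σ 1)) := by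
    have hgap := one_sub_exp_neg_pos (half_pos hσ)
    have hsq : 2 * Real.log (2 / √(min σ 1)) = Real.log (4 / min σ 1) := by
      rw [← Real.log_rpow (by positivity), Real.rpow_two, div_pow, Real.sq_sqrt hv.le]
      norm_num
    rw [hsq, ← Real.log_inv]
    refine Real.log_le_log (inv_pos.2 hgap) ?_
    rw [inv_le_comm₀ hgap (by positivity), inv_div]
    exact min_div_four_le_one_sub_exp hσ
  have hsub := Real.log_le_sub_one_of_pos (show 0 < 2 / √(min σ 1) by positivity)
  have hε : ε / (σ / 2) ≤ 2 := (div_le_iff₀ (half_pos hσ)).2 (by linarith)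
  rw [tiltDenom, show 4 / √(min σ 1) = 2 * (2 / √(min σ 1)) by ring]
  linarith

lemma tiltDenom_le_rateDenom (hσ : 0 < σ) (hT : 0 ≤ T) (hTN : T ≤ N * ε) :
    tiltDenom T σ ε ≤ 2 * rateDenom σ ε N := by
  have hlog : Real.log ((σ / 2 + T) / (σ / 2)) ≤ 2 * Real.log ((σ + N * ε) / σ) := by
    rw [← Nat.cast_ofNat (R := ℝ), ← Real.log_pow]
    refine Real.log_le_log (by positivity) ?_
    calc (σ / 2 + T) / (σ / 2) = 1 + 2 * (T / σ) := by field_simp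
      _ ≤ 1 + 2 * (N * ε / σ) + (N * ε / σ) ^ 2 := by
          have : T / σ ≤ N * ε / σ := by gcongr
          linarith [sq_nonneg (N * ε / σ)]
      _ = ((σ + N * ε) / σ) ^ 2 := by field_simp; ring
  calc tiltDenom T σ ε ≤ 2 * Real.log ((σ + N * ε) / σ) + ε / (σ / 2) :=
        add_le_add_left ((variancePotential_le_log (half_pos hσ) hT).trans hlog) _
    _ = 2 * rateDenom σ ε N := by rw [rateDenom]; ring

lemma sqrt_div_le (hc : 0 < c) (hε : 0 < ε) (hσ : 0 < σ) (hT : 0 ≤ T) (hεσ : ε ≤ σ) :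
    √(min σ 1) / (4 * (ε ^ 2 / (c * tiltDenom T σ ε))) ≤ c / ε ^ 2 := by
  have : 0 < min σ 1 := lt_min hσ one_pos
  have hD := tiltDenom_pos hε hσ hT
  have hDv := (le_div_comm₀ hD (by positivity)).1 (tiltDenom_le hσ hT hεσ)
  calc √(min σ 1) / (4 * (ε ^ 2 / (c * tiltDenom T σ ε)))
      ≤ 4 / tiltDenom T σ ε / (4 * (ε ^ 2 / (c * tiltDenom T σ ε))) := by gcongr
    _ = c / ε ^ 2 := by field_simp

lemma sq_div_rateDenom_le (hc : 0 < c) (hε : 0 < ε) (hσ : 0 < σ) (hT : 0 ≤ T)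
    (hTN : T ≤ N * ε) :
    ε ^ 2 / (c * rateDenom σ ε N) ≤ 2 * (ε ^ 2 / (c * tiltDenom T σ ε)) := by
  have hD := tiltDenom_pos hε hσ hT
  calc ε ^ 2 / (c * rateDenom σ ε N) = 2 * (ε ^ 2 / (c * (2 * rateDenom σ ε N))) := by
        field_simp
    _ ≤ 2 * (ε ^ 2 / (c * tiltDenom T σ ε)) := by
        gcongr
        exact tiltDenom_le_rateDenom hσ hT hTN

lemma le_sqrt_interpolation {p Y v E : ℝ} (hp₀ : 0 ≤ p) (hp₁ : p ≤ 1) (hv : 0 < v)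
    (hY : 1 / 4 ≤ Y) (hE : 0 ≤ E) (hp : p ≤ 192 * Y / v * E ^ 2) : p ≤ 28 * Y / √v * E := by
  refine le_of_sq_le_sq ?_ (by positivity)
  calc p ^ 2 ≤ p := pow_le_of_le_one hp₀ hp₁ two_ne_zero
    _ ≤ 192 * Y / v * E ^ 2 := hp
    _ ≤ 784 * Y ^ 2 / v * E ^ 2 := by gcongr ?_ / v * _; nlinarith only [hY]
    _ = (28 * Y / √v * E) ^ 2 := by rw [mul_pow, div_pow, Real.sq_sqrt hv.le]; ring

lemma exp_neg_div_sqrt_le {a K r v : ℝ} (ha : 0 < a) (hK : 0 < K) (hv : 0 < v)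
    (hr : √v / (4 * K) ≤ r) :
    Real.exp (-(a * K / 4)) / (√v * v) ≤
      (1 + 16 / a) * (r ^ (3 / 5 : ℝ) / v ^ (9 / 5 : ℝ)) := by
  have hpoly : (4 * K) ^ (3 / 5 : ℝ) * Real.exp (-(a * K / 4)) ≤ 1 + 16 / a := by
    have := rpow_mul_exp_neg_le (p := 3 / 5) (show 0 ≤ 4 * K by positivity) (by norm_num)
      (by norm_num) (show 0 < a / 16 by positivity)
    rwa [show a / 16 * (4 * K) = a * K / 4 by ring, one_div_div] at this
  have hpow : √v * v * √v ^ (3 / 5 : ℝ) = v ^ (9 / 5 : ℝ) := by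
    rw [Real.sqrt_eq_rpow, ← Real.rpow_mul hv.le, mul_assoc, mul_left_comm, ← Real.rpow_add hv,
      ← Real.rpow_one_add' hv.le (by norm_num)]
    norm_num
  calc Real.exp (-(a * K / 4)) / (√v * v)
      = (4 * K) ^ (3 / 5 : ℝ) * Real.exp (-(a * K / 4)) *
          ((√v / (4 * K)) ^ (3 / 5 : ℝ) / v ^ (9 / 5 : ℝ)) := by
        rw [Real.div_rpow (by positivity) (by positivity), ← hpow]
        field_simp
    _ ≤ (1 + 16 / a) * (r ^ (3 / 5 : ℝ) / v ^ (9 / 5 : ℝ)) := by gcongr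

lemma union_prefactor_le (hε : 0 < ε) (hσ : 0 < σ) (hT : 0 ≤ T) (hTN : T ≤ N * c)
    (hX : (Real.exp σ - 1) / 4 ≤ N * c / ε) :
    (8 * T / (ε * (Real.exp σ - 1)) + 1) * (4 / (1 - Real.exp (-(σ / 2)))) ≤
      192 * (N * c / ε / (Real.exp σ - 1)) / min σ 1 := by
  have hE := exp_sub_one_pos hσ
  have : 0 < min σ 1 := lt_min hσ one_pos
  set Y := N * c / ε / (Real.exp σ - 1) with hY
  have hcount : 8 * T / (ε * (Real.exp σ - 1)) + 1 ≤ 12 * Y := by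
    have hTY : 8 * T / (ε * (Real.exp σ - 1)) ≤ 8 * Y := by
      rw [hY, div_div, ← mul_div_assoc]
      gcongr
    have : 1 / 4 ≤ Y := (le_div_iff₀ hE).2 (by linarith)
    linarith
  have hboundary : 4 / (1 - Real.exp (-(σ / 2))) ≤ 4 / (min σ 1 / 4) := by
    gcongr
    exact min_div_four_le_one_sub_exp hσ
  calc _ ≤ 12 * Y * (4 / (min σ 1 / 4)) :=
        mul_le_mul hcount hboundary (by have := one_sub_exp_neg_pos (half_pos hσ); positivity)
          (le_trans (by positivity) hcount)
    _ = 192 * Y / min σ 1 := by field_simp; ring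

lemma le_failureBound {p : ℝ} (hc : 0 < c) (hε : 0 < ε) (hσ : 0 < σ) (hεσ : ε ≤ σ)
    (hcε : c ≤ ε) (hT : 0 ≤ T) (hTN : T ≤ N * c) (hX : (Real.exp σ - 1) / 4 ≤ N * c / ε)
    (hp₀ : 0 ≤ p) (hp₁ : p ≤ 1)
    (hp : p ≤ (8 * T / (ε * (Real.exp σ - 1)) + 1) * (4 / (1 - Real.exp (-(σ / 2))) *
        Real.exp (-(rateConst * (ε ^ 2 / (c * tiltDenom T σ ε)))))) :
    p ≤ failureBound (28 * (1 + 16 / rateConst)) (rateConst / 8) c ε σ N := by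
  have ha := rateConst_pos
  have hE := exp_sub_one_pos hσ
  have hD := tiltDenom_pos hε hσ hT
  have := rateDenom_pos (N := N) hσ hε
  have hv : 0 < min σ 1 := lt_min hσ one_pos
  set K := ε ^ 2 / (c * tiltDenom T σ ε)
  have hK₀ : 0 < K := by positivity
  have hsq : Real.exp (-(rateConst * K)) = Real.exp (-(rateConst * K / 2)) ^ 2 := by
    rw [← Real.exp_nat_mul]; ring_nf
  have hinterp : p ≤ 28 * (N * c / ε / (Real.exp σ - 1)) / √(min σ 1) *
      Real.exp (-(rateConst * K / 2)) := by
    refine le_sqrt_interpolation hp₀ hp₁ hv ((le_div_iff₀ hE).2 (by linarith))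
      (Real.exp_pos _).le (hp.trans ?_)
    rw [← mul_assoc, hsq]
    gcongr
    exact union_prefactor_le hε hσ hT hTN hX
  have hr : √(min σ 1) / (4 * K) ≤ c / ε ^ 2 := sqrt_div_le hc hε hσ hT hεσ
  have hrate : rateConst / 8 * (ε ^ 2 / (c * rateDenom σ ε N)) ≤ rateConst * K / 4 := by
    have : rateConst / 8 * (ε ^ 2 / (c * rateDenom σ ε N)) ≤ rateConst / 8 * (2 * K) := by
      gcongr
      exact sq_div_rateDenom_le hc hε hσ hT (hTN.trans (by gcongr))
    linarith
  have hvE : min σ 1 ≤ Real.exp σ - 1 := (min_le_left _ _).trans (le_exp_sub_one σ)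
  rw [failureBound_eq hc hε hσ]
  calc p ≤ 28 * (N * c / ε / min σ 1) / √(min σ 1) * Real.exp (-(rateConst * K / 2)) :=
        hinterp.trans (by gcongr)
    _ = 28 * (N * c / ε) * (Real.exp (-(rateConst * K / 4)) / (√(min σ 1) * min σ 1)) *
          Real.exp (-(rateConst * K / 4)) := by
        rw [show -(rateConst * K / 2) = -(rateConst * K / 4) + -(rateConst * K / 4) by ring,
          Real.exp_add]
        field_simp
    _ ≤ 28 * (N * c / ε) * ((1 + 16 / rateConst) *
          ((c / ε ^ 2) ^ (3 / 5 : ℝ) / min σ 1 ^ (9 / 5 : ℝ))) *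
          Real.exp (-(rateConst / 8 * (ε ^ 2 / (c * rateDenom σ ε N)))) := by
        gcongr ?_ * ?_ * ?_
        · exact exp_neg_div_sqrt_le ha hK₀ hv hr
        · exact Real.exp_le_exp.2 (neg_le_neg hrate)
    _ = _ := by ring

end SmallCapacity

end FailureBound

section DeviationProbability

variable {Ω : Type*} [MeasurableSpace Ω] {P : Measure Ω} [IsProbabilityMeasure P]
  {θ : ℕ → Ω → ℝ} {c : ℕ → ℝ} {cmax ε σ : ℝ} {N : ℕ}

lemma totalCap_le (hcm : ∀ k, c k ≤ cmax) (n : ℕ) : totalCap c n ≤ n * cmax := by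
  simpa [totalCap] using Finset.sum_le_card_nsmul (Finset.range n) c cmax fun k _ => hcm k

/-- The tilt minimising the exponent in `measureReal_le_maxFluct_le` when the accumulated variance
is `D`. -/
noncomputable def optimalTilt (c D ε : ℝ) : ℝ := ε / (6 * (16 * jumpConst) * (c * D))

lemma admissibleTilt_optimalTilt {c D : ℝ} (hc : 0 < c) (hε : 0 < ε) (hσ : 0 < σ)
    (hc₁ : c ≤ 1) (hcσ : c ≤ σ ^ 3) (hD : ε / (σ / 2) ≤ D) :
    AdmissibleTilt c (σ / 2) (optimalTilt c D ε) where
  cap_le_one := hc₁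
  pos := half_pos hσ
  cap_le_cube := by rwa [mul_div_cancel₀ σ two_ne_zero]
  tilt_nonneg := by
    have hD₀ : 0 < D := (div_pos hε (half_pos hσ)).trans_le hD
    have := jumpConst_pos
    unfold optimalTilt
    positivity
  tilt_mul_cap_le := by
    have hD₀ : 0 < D := (div_pos hε (half_pos hσ)).trans_le hD
    have := jumpConst_pos
    have hεD : ε / D ≤ σ / 2 := (div_le_comm₀ (half_pos hσ) hD₀).1 hD
    calc 16 * jumpConst * (optimalTilt c D ε * c) = ε / D / 6 := by
          unfold optimalTilt
          field_simp
      _ ≤ σ / 2 := by linarith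

lemma tiltRate_optimalTilt {c D : ℝ} (hc : 0 < c) (hD : 0 < D) :
    tiltRate c (optimalTilt c D ε) * D - optimalTilt c D ε * ε / 3 =
      -(rateConst * (ε ^ 2 / (c * D))) := by
  have := jumpConst_pos
  unfold tiltRate optimalTilt rateConst
  field_simp
  ring

lemma maxFluct_lt_of_small_cap (hc : ∀ k, 0 ≤ c k) (hcm : ∀ k, c k ≤ cmax) (hε : 0 < ε)
    (hσ : 0 < σ) (hX : N * cmax / ε ≤ (Real.exp σ - 1) / 4) (θ : ℕ → ℝ) :
    maxFluct c θ N σ < ENNReal.ofReal ε := by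
  have hE := exp_sub_one_pos hσ
  refine lt_of_le_of_lt (iSup₂_le fun n hn => iSup₂_le fun z hz => ?_)
    ((ENNReal.ofReal_lt_ofReal_iff hε).2 (half_lt_self hε))
  rw [← ofReal_norm]
  refine ENNReal.ofReal_le_ofReal ((norm_clusterFluct_le hc θ n hσ hz).trans ?_)
  rw [div_le_iff₀ hE]
  have hcap : totalCap c n ≤ N * cmax := (totalCap_mono hc hn).trans (totalCap_le hcm N)
  have := (div_le_iff₀ hε).1 hX
  linarith

lemma measureReal_le_maxFluct_le_failureBound (hθ : IsUniformAngles θ P) (hc : ∀ k, 0 ≤ c k)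
    (hcm : ∀ k, c k ≤ cmax) (hcmax : 0 < cmax) (hε : 0 < ε) (hσ : 0 < σ) (hεσ : ε ≤ σ)
    (hcσ : cmax ≤ σ ^ 3) :
    P.real {ω | ENNReal.ofReal ε ≤ maxFluct c (fun k => θ k ω) N σ} ≤
      failureBound (28 * (1 + 16 / rateConst)) (rateConst / 8) cmax ε σ N := by
  have := rateConst_pos
  rcases le_or_gt (N * cmax / ε) ((Real.exp σ - 1) / 4) with hX | hX
  · have hempty : {ω | ENNReal.ofReal ε ≤ maxFluct c (fun k => θ k ω) N σ} = ∅ :=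
      Set.eq_empty_of_forall_notMem fun ω hω =>
        (maxFluct_lt_of_small_cap hc hcm hε hσ hX fun k => θ k ω).not_ge hω
    rw [hempty, measureReal_empty]
    exact failureBound_nonneg (by positivity) hcmax hε hσ
  by_cases hlarge : ε < cmax ∨ 1 < cmax
  · have hA : 16 ≤ 28 * (1 + 16 / rateConst) := by
      have : 0 < 16 / rateConst := by positivity
      linarith
    have ha : rateConst / 8 ≤ 1 / 16 := by linarith [rateConst_le_half]
    exact measureReal_le_one.trans
      (one_le_failureBound hA ha hcmax hε hσ hεσ hcσ hlarge hX.le)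
  obtain ⟨hcε, hc₁⟩ : cmax ≤ ε ∧ cmax ≤ 1 := by simpa only [not_or, not_lt] using hlarge
  have hT := totalCap_nonneg hc N
  set D := tiltDenom (totalCap c N) σ ε
  have hσD : ε / (σ / 2) ≤ D := div_half_le_tiltDenom hσ hT
  have hVD : variancePotential (totalCap c N) (σ / 2) ≤ D :=
    le_add_of_nonneg_right (by positivity)
  refine le_failureBound hcmax hε hσ hεσ hcε hT (totalCap_le hcm N) hX.le measureReal_nonneg
    measureReal_le_one ((measureReal_le_maxFluct_le hθ hc hcm
      (admissibleTilt_optimalTilt hcmax hε hσ hc₁ hcσ hσD) hε N).trans ?_)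
  have := one_sub_exp_neg_pos (half_pos hσ)
  have := exp_sub_one_pos hσ
  have := tiltRate_nonneg hcmax.le (optimalTilt cmax D ε)
  rw [← tiltRate_optimalTilt hcmax (tiltDenom_pos hε hσ hT)]
  gcongr

lemma le_cube_of_rpow_one_third_le {x y : ℝ} (hx : 0 ≤ x) (h : x ^ (1 / 3 : ℝ) ≤ y) :
    x ≤ y ^ 3 := by
  calc x = (x ^ (1 / 3 : ℝ)) ^ 3 := by
        rw [← Real.rpow_natCast, ← Real.rpow_mul hx]
        norm_num
    _ ≤ y ^ 3 := by gcongr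

end DeviationProbability

end HastingsLevitov

theorem theorem5p1_general : ∃ A A' : ℝ, 0 < A ∧ 0 < A' ∧
    ∀ (Ω : Type*) [MeasurableSpace Ω] (P : Measure Ω) [IsProbabilityMeasure P]
      (θ : ℕ → Ω → ℝ), (∀ k, Measurable (θ k)) → iIndepFun θ P →
      (∀ k, pdf.IsUniform (θ k) (Set.Ico 0 (2 * Real.pi)) P) →
    ∀ (cmax : ℝ) (c : ℕ → ℝ), 0 < cmax → (∀ k, 0 ≤ c k ∧ c k ≤ cmax) →
    ∀ (N : ℕ) (σ ε : ℝ), 0 < ε → ε ≤ σ → cmax ≤ σ ^ 3 →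
      1 - A * N * (cmax ^ (8 / 5 : ℝ) / (ε ^ (11 / 5 : ℝ) * min (σ ^ (9 / 5 : ℝ)) 1)) *
          Real.exp (-(A' / (Real.log ((σ + N * ε) / σ) + ε / σ) * (ε ^ 2 / cmax)))
        ≤ P.real {ω | (⨆ n ≤ N, ⨆ z ∈ {z : ℂ | σ < z.re},
            ‖HastingsLevitov.logClusterMap c (fun k => θ k ω) n z - z
              - HastingsLevitov.totalCap c n‖ₑ) < ENNReal.ofReal ε} := by
  open HastingsLevitov in
  have ha := rateConst_pos
  refine ⟨28 * (1 + 16 / rateConst), rateConst / 8, by positivity, by positivity, ?_⟩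
  intro Ω _ P _ θ hm hi hu cmax c hcmax hc N σ ε hε hεσ hcσ
  have hfail := measureReal_le_maxFluct_le_failureBound (N := N)
    (⟨hm, hi, hu⟩ : IsUniformAngles θ P) (fun k => (hc k).1) (fun k => (hc k).2)
    hcmax hε (hε.trans_le hεσ) hεσ hcσ
  refine le_trans (sub_le_sub_left ?_ 1)
    (one_sub_measureReal_compl_le {ω | maxFluct c (fun k => θ k ω) N σ < ENNReal.ofReal ε})
  simp only [Set.compl_ofPred, not_lt]
  exact hfail

theorem theorem5p1 : ∃ A A' : ℝ, 0 < A ∧ 0 < A' ∧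
    ∀ (Ω : Type*) [MeasurableSpace Ω] (P : Measure Ω) [IsProbabilityMeasure P]
      (θ : ℕ → Ω → ℝ), (∀ k, Measurable (θ k)) → iIndepFun θ P →
      (∀ k, pdf.IsUniform (θ k) (Set.Ico 0 (2 * Real.pi)) P) →
    ∀ (cmax : ℝ) (c : ℕ → ℝ), (∀ k, 0 < c k ∧ c k ≤ cmax) →
    ∀ (N : ℕ) (σ ε : ℝ), 0 < σ → 0 < ε → ε < σ / 3 →
      max (HastingsLevitov.slitLength cmax) (cmax ^ (1 / 3 : ℝ)) < σ - 3 * ε →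
      1 - A * N * (cmax ^ (8 / 5 : ℝ) /
            (ε ^ (11 / 5 : ℝ) * min ((σ - 3 * ε) ^ (9 / 5 : ℝ)) 1)) *
          Real.exp (-(A' / (Real.log (1 / (σ - 3 * ε)) + Real.log (σ + N * ε) + ε / (σ - ε)) *
            (ε ^ 2 / cmax)))
        ≤ P.real {ω | (⨆ n ≤ N, ⨆ z ∈ {z : ℂ | σ < z.re},
            ‖HastingsLevitov.logClusterMap c (fun k => θ k ω) n z - z
              - HastingsLevitov.totalCap c n‖ₑ) < ENNReal.ofReal ε} := by
  obtain ⟨A, A', hA, hA', h⟩ := theorem5p1_general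
  refine ⟨A, A', hA, hA', fun Ω _ P _ θ hm hi hu cmax c hc N σ ε _ hε hεσ hmax => ?_⟩
  have hcmax : 0 < cmax := (hc 0).1.trans_le (hc 0).2
  have hcσ : cmax ≤ σ ^ 3 := HastingsLevitov.le_cube_of_rpow_one_third_le hcmax.le
    (by linarith [(le_max_right _ _).trans_lt hmax])
  exact (sub_le_sub_left (HastingsLevitov.failureBound_le hA.le hA'.le hcmax (by linarith) hε
    (by linarith) (by linarith)) 1).trans
    (h Ω P θ hm hi hu cmax c hcmax (fun k => ⟨(hc k).1.le, (hc k).2⟩) N σ ε hε (by linarith) hcσ)
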